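/- Let $T=(T_i)_{i\in\mathcal V}$ be a finite tensor network with nonnegative entries: every variable $e\in\mathcal E$ takes values in the same finite set $X$ and is shared by exactly two distinct tensors. Join two tensors by an edge if they share a variable, and suppose that the resulting simple graph $\mathcal G$ is connected. Let $T(x)=\prod_i T_i(x)$, suppose that $Z=\mathrm{Tr}(T)=\sum_x T(x)\neq 0$, and put $p(x)=T(x)/Z$. Let $\ell_0\in\mathbb N$ (the KCN-parameter) be such that every cycle of $\mathcal G$ has length at most $\ell_0$. Let $S_i$ consist of $T_i$, its nearest neighbors, and all the tensors on a path of length at most $\ell_0$ joining two distinct nearest neighbors of $T_i$; put $S_{i\setminus j}=S_i\setminus S_j$ and $S_{i\cap j}=S_i\cap S_j$. For $j\in S_i$, a message $m_{i\to j}$ is a real function on the assignments of the set $T_{i\setminus j}$ of those variables of $T_i$ that are shared by some tensor outside $S_j$. The messages $m^{(0)}_{i\to j}$ are uniform with total mass one, and $$m^{(t+1)}_{i\to j}=\frac1{c^{(t)}_{i\to j}}\mathrm{Tr}_{\setminus T_{i\setminus j}}\Big(\prod_{k\in S_{i\setminus j}}T_k\,m^{(t)}_{k\to i}\Big),$$ where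 $\mathrm{Tr}_{\setminus T_{i\setminus j}}$ sums over all the variables of the tensors in $S_{i\setminus j}$ except those in $T_{i\setminus j}$, and the constant $c^{(t)}_{i\to j}$ makes the total mass one. A family of messages is converged if it is a fixed point of this update. Let $M^{(0)}_{i\to j}=1$, $M^{(t+1)}_{i\to j}=c^{(t)}_{i\to j}\prod_{k\in S_{i\setminus j}}M^{(t)}_{k\to i}$ be the accumulated normalization constants, and let $n^{(t)}_{i\to j}=M^{(t)}_{i\to j}m^{(t)}_{i\to j}$. Let $((i,j))\in\mathcal G$ range over the unordered pairs of distinct tensors with $T_i\in S_j$ and $T_j\in S_i$, each pair being taken in one of its two orders, chosen arbitrarily. Below, $\mathrm{Tr}$ of a product that contains tensors sums over all the variables of these tensors, $S_i$ and $S_{i\cap j}$ also denote the products of their tensors, and a factor $m_{j\to j}$ (a function of no variables) equals one. Then: 1. There is a $t_0$ such that for all $t\ge t_0$ the messages $m^{(t)}=m^{(t_0)}$ are converged, $Z=\mathrm{Tr}\big(S_i\prod_{j\in S_i}n^{(t)}_{j\to i}\big)$ for all $i$, and $Z=\mathrm{Tr}\big(S_{i\cap j}\,n^{(t)}_{j\to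 i}\prod_{k\in S_{i\cap j}}n^{(t)}_{k\to j}\big)$ for all pairs $((i,j))\in\mathcal G$. 2. For all converged messages $m$, the contraction $\mathrm{Tr}\big(S_{i\cap j}\,m_{j\to i}\prod_{k\in S_{i\cap j}}m_{k\to j}\big)$ does not change when $i$ and $j$ are exchanged, and $$Z=\frac{\prod_{i\in\mathcal V}\mathrm{Tr}\big(S_i\prod_{j\in S_i}m_{j\to i}\big)}{\prod_{((i,j))\in\mathcal G}\mathrm{Tr}\big(S_{i\cap j}\,m_{j\to i}\prod_{k\in S_{i\cap j}}m_{k\to j}\big)^{2/|S_{i\cap j}|}}.$$ 3. All the normalization constants cancel: for every $t$, $$\frac{\prod_{i\in\mathcal V}\prod_{j\in S_i}M^{(t)}_{j\to i}}{\prod_{((i,j))\in\mathcal G}\Big(M^{(t)}_{j\to i}\prod_{k\in S_{i\cap j}\setminus\{j\}}M^{(t)}_{k\to j}\Big)^{2/|S_{i\cap j}|}}=1.$$ 4. Let $p_{N_i}$ and $p_{N_{i\cap j}}$ be the marginals of $p$ on the variables that the tensors in $S_i$, respectively $S_{i\cap j}$, depend on. Then for all $x$ $$p(x)=\frac{\prod_{i\in\mathcal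 V}p_{N_i}(x_{N_i})}{\prod_{((i,j))\in\mathcal G}p_{N_{i\cap j}}(x_{N_{i\cap j}})^{2/|S_{i\cap j}|}},$$ where the right-hand side is read as $0$ if its denominator vanishes. -/

import Mathlib

/-- A (finite) tensor network with nonnegative entries. `V` indexes the tensors, `E` indexes the
variables, and every variable takes values in the same finite set `X`. Every variable is shared by
exactly two distinct tensors, and the tensor `i` depends on the variables it is an endpoint of. -/
structure TensorNetwork (V E X : Type*) where
  ends : E → Sym2 V
  ends_not_diag : ∀ e, ¬ (ends e).IsDiag
  tensor : ∀ i : V, ({e : E // i ∈ ends e} → X) → ℝ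
  tensor_nonneg : ∀ i x, 0 ≤ tensor i x

namespace TensorNetwork

variable {V E X : Type*}

/-- The simplified graph: two tensors are adjacent if they share a variable. -/
def graph (N : TensorNetwork V E X) : SimpleGraph V where
  Adj i j := i ≠ j ∧ ∃ e, N.ends e = s(i, j)
  symm := ⟨fun _ _ h => ⟨h.1.symm, h.2.imp fun _ he => he.trans Sym2.eq_swap⟩⟩
  loopless := ⟨fun _ h => h.1 rfl⟩

/-- Every loop of the simplified graph has length at most `ℓ`. -/
def LoopsBounded (N : TensorNetwork V E X) (ℓ : ℕ) : Prop :=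
  ∀ (v : V) (c : N.graph.Walk v v), c.IsCycle → c.length ≤ ℓ

variable [Fintype V] [Fintype E] [Fintype X]

open scoped Classical in
/-- The tensor-neighborhood `S_i`: the tensor `i`, its nearest neighbors, and all the tensors on a
path of length at most `ℓ` joining two nearest neighbors of `i`. -/
noncomputable def nbhd (N : TensorNetwork V E X) (ℓ : ℕ) (i : V) : Finset V :=
  Finset.univ.filter fun v =>
    v = i ∨ N.graph.Adj i v ∨
      ∃ a b, N.graph.Adj i a ∧ N.graph.Adj i b ∧ a ≠ b ∧
        ∃ p : N.graph.Walk a b, p.IsPath ∧ p.length ≤ ℓ ∧ v ∈ p.support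

open scoped Classical in
/-- The neighborhood difference `S_i \ S_j`. -/
noncomputable def nbhdDiff (N : TensorNetwork V E X) (ℓ : ℕ) (i j : V) : Finset V :=
  N.nbhd ℓ i \ N.nbhd ℓ j

open scoped Classical in
/-- The neighborhood intersection `S_i ∩ S_j`. -/
noncomputable def nbhdInter (N : TensorNetwork V E X) (ℓ : ℕ) (i j : V) : Finset V :=
  N.nbhd ℓ i ∩ N.nbhd ℓ j

open scoped Classical in
/-- The variables that some tensor in `A` depends on. -/
noncomputable def vars (N : TensorNetwork V E X) (A : Finset V) : Finset E :=
  Finset.univ.filter fun e => ∃ k ∈ A, k ∈ N.ends e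

open scoped Classical in
/-- The set `T_{i \ j}` of variables that the tensor `i` depends on and that are shared by some
tensor not belonging to `S_j`. -/
noncomputable def outVars (N : TensorNetwork V E X) (ℓ : ℕ) (i j : V) : Finset E :=
  Finset.univ.filter fun e => i ∈ N.ends e ∧ ∃ k ∈ N.ends e, k ∉ N.nbhd ℓ j

lemma mem_vars (N : TensorNetwork V E X) {A : Finset V} {k : V} (hk : k ∈ A) {e : E}
    (he : k ∈ N.ends e) : e ∈ N.vars A := by
  classical
  exact Finset.mem_filter.2 ⟨Finset.mem_univ _, k, hk, he⟩

lemma outVars_subset (N : TensorNetwork V E X) (ℓ : ℕ) {A : Finset V} {k : V} (hk : k ∈ A)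
    (i : V) : N.outVars ℓ k i ⊆ N.vars A := by
  classical
  intro e he
  exact N.mem_vars hk (Finset.mem_filter.1 he).2.1

lemma outVars_subset_vars_nbhdDiff (N : TensorNetwork V E X) (ℓ : ℕ) (i j : V) :
    N.outVars ℓ i j ⊆ N.vars (N.nbhdDiff ℓ i j) := by
  classical
  intro e he
  obtain ⟨hi, k, hk, hkj⟩ := (Finset.mem_filter.1 he).2
  refine N.mem_vars (Finset.mem_sdiff.2 ⟨Finset.mem_filter.2 ⟨Finset.mem_univ _, ?_⟩, hkj⟩) hk
  by_cases h : k = i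
  · exact Or.inl h
  · exact Or.inr (Or.inl ⟨fun h' => h h'.symm, e, (Sym2.mem_and_mem_iff (Ne.symm h)).1 ⟨hi, hk⟩⟩)

/-- A family of messages `m_{i → j}`, each a function of the variables in `T_{i \ j}`. Only the
messages with `j ∈ S_i` are meaningful. -/
abbrev Messages (N : TensorNetwork V E X) (ℓ : ℕ) : Type _ :=
  ∀ i j : V, (N.outVars ℓ i j → X) → ℝ

/-- The value, on an assignment `x` of the variables of `A`, of the product of the tensors in `A`
and of the messages `m_{k → τ k}`, `k ∈ A`. -/
noncomputable def weight (N : TensorNetwork V E X) (ℓ : ℕ) (m : N.Messages ℓ) (A : Finset V)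
    (τ : V → V) (x : N.vars A → X) : ℝ :=
  ∏ k : A, (N.tensor k (fun e => x ⟨e, N.mem_vars k.2 e.2⟩) *
    m k (τ k) (fun e => x ⟨e, N.outVars_subset ℓ k.2 (τ k) e.2⟩))

open scoped Classical in
/-- The full contraction of the tensors in `A` with the messages `m_{k → τ k}`, `k ∈ A`. -/
noncomputable def contract (N : TensorNetwork V E X) (ℓ : ℕ) (m : N.Messages ℓ) (A : Finset V)
    (τ : V → V) : ℝ :=
  ∑ x : N.vars A → X, N.weight ℓ m A τ x

open scoped Classical in
/-- The unnormalized update `Tr (S_{i \ j} ∏_{k ∈ S_{i \ j}} m_{k → i})`, in which all variables but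
those in `T_{i \ j}` are summed over. -/
noncomputable def rawUpdate (N : TensorNetwork V E X) (ℓ : ℕ) (m : N.Messages ℓ) : N.Messages ℓ :=
  fun i j y =>
    ∑ x : N.vars (N.nbhdDiff ℓ i j) → X with
      (fun e : N.outVars ℓ i j => x ⟨e, N.outVars_subset_vars_nbhdDiff ℓ i j e.2⟩) = y,
      N.weight ℓ m (N.nbhdDiff ℓ i j) (fun _ => i) x

open scoped Classical in
/-- The normalization constant of the update of `m_{i → j}`. -/
noncomputable def normConst (N : TensorNetwork V E X) (ℓ : ℕ) (m : N.Messages ℓ) (i j : V) : ℝ :=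
  ∑ y : N.outVars ℓ i j → X, N.rawUpdate ℓ m i j y

/-- The update, normalized such that every message sums to one. -/
noncomputable def update (N : TensorNetwork V E X) (ℓ : ℕ) (m : N.Messages ℓ) : N.Messages ℓ :=
  fun i j y => N.rawUpdate ℓ m i j y / N.normConst ℓ m i j

/-- The messages `m_{i → j}^{(t)}`, uniformly initialized. -/
noncomputable def messages (N : TensorNetwork V E X) (ℓ : ℕ) : ℕ → N.Messages ℓ
  | 0 => fun i j _ => 1 / (Fintype.card X : ℝ) ^ (N.outVars ℓ i j).card
  | t + 1 => N.update ℓ (messages N ℓ t)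

/-- The product `M_{i → j}^{(t)}` of all the normalization constants that have entered
`m_{i → j}^{(t)}`: the one of its last update and those carried by the messages used there. -/
noncomputable def accumConst (N : TensorNetwork V E X) (ℓ : ℕ) : ℕ → V → V → ℝ
  | 0 => fun _ _ => 1
  | t + 1 => fun i j =>
      N.normConst ℓ (N.messages ℓ t) i j * ∏ k ∈ N.nbhdDiff ℓ i j, accumConst N ℓ t k i

/-- The messages `n_{i → j}^{(t)} = M_{i → j}^{(t)} m_{i → j}^{(t)}`, without normalization. -/
noncomputable def rawMessages (N : TensorNetwork V E X) (ℓ : ℕ) (t : ℕ) : N.Messages ℓ :=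
  fun i j y => N.accumConst ℓ t i j * N.messages ℓ t i j y

/-- Converged messages: the family is a fixed point of the update equations. -/
def IsConverged (N : TensorNetwork V E X) (ℓ : ℕ) (m : N.Messages ℓ) : Prop :=
  ∀ i, ∀ j ∈ N.nbhd ℓ i, m i j = N.update ℓ m i j

open scoped Classical in
/-- In the contraction attached to a pair `(i, j)`, the tensor `j` sends its message to `i`, and
every other tensor in `S_{i ∩ j}` sends its message to `j`. (The message `m_{j → j}` has no
variables and equals one, so it is left out.) -/
noncomputable def pairTarget (i j : V) : V → V := fun k => if k = j then i else j

/-- `Tr (S_i ∏_{j ∈ S_i} m_{j → i})`. -/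
noncomputable def nbhdTrace (N : TensorNetwork V E X) (ℓ : ℕ) (m : N.Messages ℓ) (i : V) : ℝ :=
  N.contract ℓ m (N.nbhd ℓ i) (fun _ => i)

/-- `Tr (S_{i ∩ j} m_{j → i} ∏_{k ∈ S_{i ∩ j}} m_{k → j})`. -/
noncomputable def interTrace (N : TensorNetwork V E X) (ℓ : ℕ) (m : N.Messages ℓ) (i j : V) : ℝ :=
  N.contract ℓ m (N.nbhdInter ℓ i j) (pairTarget i j)

/-- `i` and `j` are distinct tensors with `i ∈ S_j` and `j ∈ S_i`. -/
def IsNbhdPair (N : TensorNetwork V E X) (ℓ : ℕ) (i j : V) : Prop :=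
  i ≠ j ∧ i ∈ N.nbhd ℓ j ∧ j ∈ N.nbhd ℓ i

/-- `P` lists every unordered neighborhood pair exactly once, in one of its two orders. -/
def IsPairList (N : TensorNetwork V E X) (ℓ : ℕ) (P : Finset (V × V)) : Prop :=
  (∀ q ∈ P, N.IsNbhdPair ℓ q.1 q.2) ∧
    ∀ i j, N.IsNbhdPair ℓ i j → ((i, j) ∈ P ↔ (j, i) ∉ P)

/-- The product of all the tensors on a full configuration. -/
noncomputable def value (N : TensorNetwork V E X) (x : E → X) : ℝ :=
  ∏ i, N.tensor i (fun e => x e)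

open scoped Classical in
/-- The partition function `Z = Tr (T)`. -/
noncomputable def Z (N : TensorNetwork V E X) : ℝ := ∑ x : E → X, N.value x

/-- The probability of a full configuration. -/
noncomputable def prob (N : TensorNetwork V E X) (x : E → X) : ℝ := N.value x / N.Z

open scoped Classical in
/-- The marginal of `prob` on the variables that the tensors in `A` depend on. -/
noncomputable def marginal (N : TensorNetwork V E X) (A : Finset V) (y : N.vars A → X) : ℝ :=
  ∑ x : E → X with (N.vars A).restrict x = y, N.prob x

end TensorNetwork

/-! ### Paths, cut vertices and cycles in a simple graph. -/

namespace SimpleGraph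

variable {V : Type*} {G : SimpleGraph V}

/-! The bound on cycle lengths makes the neighborhoods purely topological: `v` lies in `S_i` exactly
when no third vertex separates `v` from `i` (`mem_nbhd`), that is, when `v = i` or both share a
block of the graph. Two distinct vertices determine their block (`Nonsep.of_common`), so `S_i ∩ S_j`
is the common block of a pair, and the blocks hang together in a tree.

Cutting at `k` isolates the branch of `k` away from `i`. The vertices of `S_i`, each with its branch
away from `i`, partition the whole graph; similarly for `S_i ∩ S_j`, and for `S_i \ S_j` inside the
branch of `i` away from `j`. These partitions (`IsBranchCover`) factorize contractions, since a
variable leaving a branch must touch its root. Hence the unnormalized message from `i` to `j` is the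
exact contraction of a branch once `t` exceeds its size (`rawMessages_eq_branchSum`): branches nest
strictly, so the recursion ends before it reaches the initial values. The same nesting makes
converged messages unique.

All product formulas come from one identity, `prod_prod_eq_mul_prod_rpow`. If `f k i` for `i ≠ k`
depends only on `k` and the block of `k` and `i`, each vertex of a block of size `n` contributes its
factor `n - 1` times; the block has `n (n - 1) / 2` pairs, and the exponent `2 / n` on each gives `n
- 1` as well. With `f` the accumulated constants this is their cancellation, with `f` tensor times
branch contraction it is the factorization of `p`, and with `f` a power counting branch vertices it
yields the power of `Z` that is left over. -/

lemma Walk.IsPath.append_of_inter {u v w : V} {p : G.Walk u v} {q : G.Walk v w} (hp : p.IsPath)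
    (hq : q.IsPath) (h : ∀ x ∈ p.support, x ∈ q.support → x = v) : (p.append q).IsPath := by
  induction p with
  | nil => simpa using hq
  | cons hadj p ih =>
    rw [Walk.cons_isPath_iff] at hp
    rw [Walk.cons_append, Walk.cons_isPath_iff]
    refine ⟨ih hp.1 hq fun x hx hxq => h x (by simp [hx]) hxq, fun hmem => ?_⟩
    rw [Walk.mem_support_append_iff] at hmem
    rcases hmem with hmem | hmem
    · exact hp.2 hmem
    · have := h _ (by simp) hmem
      subst this
      exact hp.2 p.end_mem_support

/-- The vertices `u` and `v` are joined by a walk that avoids `k`. -/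
def AvoidReach (G : SimpleGraph V) (k u v : V) : Prop := ∃ p : G.Walk u v, k ∉ p.support

namespace AvoidReach

lemma refl {k u : V} (h : k ≠ u) : G.AvoidReach k u u := ⟨Walk.nil, by simpa using h⟩

lemma symm {k u v : V} (h : G.AvoidReach k u v) : G.AvoidReach k v u := by
  obtain ⟨p, hp⟩ := h
  exact ⟨p.reverse, by simpa using hp⟩

lemma trans {k u v w : V} (h : G.AvoidReach k u v) (h' : G.AvoidReach k v w) :
    G.AvoidReach k u w := by
  obtain ⟨p, hp⟩ := h
  obtain ⟨q, hq⟩ := h'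
  exact ⟨p.append q, by simp [Walk.mem_support_append_iff, hp, hq]⟩

lemma ne_left {k u v : V} (h : G.AvoidReach k u v) : k ≠ u := by
  obtain ⟨p, hp⟩ := h
  rintro rfl
  exact hp p.start_mem_support

lemma ne_right {k u v : V} (h : G.AvoidReach k u v) : k ≠ v := h.symm.ne_left

lemma of_adj {k u v : V} (h : G.Adj u v) (hu : k ≠ u) (hv : k ≠ v) : G.AvoidReach k u v :=
  ⟨Walk.cons h Walk.nil, by simp [hu, hv]⟩

lemma or_of_between {a i v : V} (h : G.AvoidReach a i v) (b : V) :
    G.AvoidReach a i b ∨ G.AvoidReach b i v := by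
  classical
  obtain ⟨p, hp⟩ := h
  by_cases hb : b ∈ p.support
  · exact Or.inl ⟨p.takeUntil b hb, fun h' => hp (p.support_takeUntil_subset_support hb h')⟩
  · exact Or.inr ⟨p, hb⟩

end AvoidReach

/-- On a walk from `c` to `v`, the tail after the last visit to `{c, d}` starts at one of the two
and avoids the other. -/
lemma Connected.avoidReach_or (hG : G.Connected) {c d : V} (hcd : c ≠ d) (v : V) :
    G.AvoidReach c d v ∨ G.AvoidReach d c v := by
  have key : ∀ (u : V) (p : G.Walk u v), (G.AvoidReach c d v ∨ G.AvoidReach d c v) ∨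
      (c ∉ p.support ∧ d ∉ p.support) := by
    intro u p
    induction p with
    | nil =>
      rename_i u
      by_cases hc : c = u
      · subst hc; exact Or.inl (Or.inr (AvoidReach.refl hcd.symm))
      by_cases hd : d = u
      · subst hd; exact Or.inl (Or.inl (AvoidReach.refl hcd))
      exact Or.inr (by simp [hc, hd])
    | cons h p ih =>
      rename_i u w t
      rcases ih with ih | ⟨h1, h2⟩
      · exact Or.inl ih
      by_cases hc : c = u
      · subst hc; exact Or.inl (Or.inr ⟨Walk.cons h p, by simp [h2, hcd.symm]⟩)
      by_cases hd : d = u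
      · subst hd; exact Or.inl (Or.inl ⟨Walk.cons h p, by simp [h1, hcd]⟩)
      exact Or.inr (by simp [hc, hd, h1, h2])
  obtain ⟨p⟩ := hG.preconnected c v
  rcases key c p with h | h
  · exact h
  · exact absurd p.start_mem_support h.1

/-- No third vertex separates `i` from `j`. -/
def Nonsep (G : SimpleGraph V) (i j : V) : Prop := ∀ c, c ≠ i → c ≠ j → G.AvoidReach c i j

lemma Nonsep.refl (i : V) : G.Nonsep i i := fun _ h _ => AvoidReach.refl h

lemma Nonsep.symm {i j : V} (h : G.Nonsep i j) : G.Nonsep j i := fun c h1 h2 => (h c h2 h1).symm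

lemma Nonsep.of_adj {i j : V} (h : G.Adj i j) : G.Nonsep i j := fun _ => AvoidReach.of_adj h

/-- `w` lies on a cycle through `i`, given as a path between two neighbors of `i` that is cut
at `w`. -/
def OnCycle (G : SimpleGraph V) (i w : V) : Prop :=
  ∃ a b, G.Adj i a ∧ G.Adj i b ∧ a ≠ b ∧ ∃ (p : G.Walk a w) (q : G.Walk w b),
    (p.append q).IsPath ∧ i ∉ (p.append q).support

lemma onCycle_of_mem_path {i w a b : V} (ha : G.Adj i a) (hb : G.Adj i b) (hab : a ≠ b)
    (p : G.Walk a b) (hp : p.IsPath) (hi : i ∉ p.support) (hw : w ∈ p.support) :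
    G.OnCycle i w := by
  classical
  exact ⟨a, b, ha, hb, hab, p.takeUntil w hw, p.dropUntil w hw, by simpa using hp, by simpa using hi⟩

lemma Walk.exists_first_hit (S : Set V) {u t : V} (p : G.Walk u t) (ht : t ∈ S) :
    ∃ z ∈ S, ∃ q : G.Walk u z, q.IsPath ∧ (∀ x ∈ q.support, x ∈ p.support) ∧
      ∀ x ∈ q.support, x ∈ S → x = z := by
  classical
  suffices h : ∃ z ∈ S, ∃ q : G.Walk u z, (∀ x ∈ q.support, x ∈ p.support) ∧
      ∀ x ∈ q.support, x ∈ S → x = z by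
    obtain ⟨z, hz, q, h1, h2⟩ := h
    refine ⟨z, hz, q.bypass, q.bypass_isPath, fun x hx => h1 x (q.support_bypass_subset_support hx),
      fun x hx => h2 x (q.support_bypass_subset_support hx)⟩
  induction p with
  | nil => exact ⟨_, ht, Walk.nil, by simp, by simp⟩
  | cons h p ih =>
    rename_i u w t
    by_cases hu : u ∈ S
    · exact ⟨u, hu, Walk.nil, by simp, by simp⟩
    obtain ⟨z, hz, q, h1, h2⟩ := ih ht
    refine ⟨z, hz, Walk.cons h q, ?_, ?_⟩
    · intro x hx
      rw [Walk.support_cons, List.mem_cons] at hx ⊢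
      exact hx.imp_right (h1 x)
    · intro x hx hxS
      rw [Walk.support_cons, List.mem_cons] at hx
      rcases hx with rfl | hx
      · exact absurd hxS hu
      · exact h2 x hx hxS

lemma Walk.exists_walk_to_neighbor {v i : V} (p : G.Walk v i) (hv : v ≠ i) :
    ∃ a, G.Adj i a ∧ ∃ q : G.Walk v a, i ∉ q.support ∧ ∀ x ∈ q.support, x ∈ p.support := by
  induction p with
  | nil => exact absurd rfl hv
  | cons h p ih =>
    rename_i u w t
    by_cases hw : w = t
    · subst hw
      exact ⟨u, h.symm, Walk.nil, by simpa using hv.symm, by simp⟩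
    obtain ⟨a, ha, q, h1, h2⟩ := ih hw
    refine ⟨a, ha, Walk.cons h q, by simp [hv.symm, h1], ?_⟩
    intro x hx
    rw [Walk.support_cons, List.mem_cons] at hx ⊢
    exact hx.imp_right (h2 x)

/-- Reroute the cycle through `v`: follow `p` from `a` to `z`, then `r` backwards to `v`, the edge
to `w`, and `q` on to `b`. The arc of `p` between `z` and `w` is dropped. -/
lemma onCycle_of_split {i v w a b z : V} (ha : G.Adj i a) (hb : G.Adj i b) (hab : a ≠ b)
    (p : G.Walk a w) (q : G.Walk w b) (hpq : (p.append q).IsPath) (hi : i ∉ (p.append q).support)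
    (hwv : G.Adj w v) (r : G.Walk v z) (hr : r.IsPath) (hir : i ∉ r.support)
    (hrw : w ∉ r.support) (hrz : ∀ x ∈ r.support, x ∈ (p.append q).support → x = z)
    (hz : z ∈ p.support) : G.OnCycle i v := by
  classical
  have hzw : z ≠ w := fun h => hrw (h ▸ r.end_mem_support)
  have hp : p.IsPath := hpq.of_append_left
  have hq : q.IsPath := hpq.of_append_right
  have hdisj : ∀ x ∈ p.support, x ∈ q.support → x = w := by
    intro x hx hx'
    by_contra hne
    exact hpq.ne_of_mem_support_of_append hne hx hx' rfl
  have hwt : w ∉ (p.takeUntil z hz).support := by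
    exact Walk.endpoint_notMem_support_takeUntil hp hz hzw.symm
  have hsub : ∀ x ∈ (p.takeUntil z hz).support, x ∈ p.support := fun x hx =>
    p.support_takeUntil_subset_support hz hx
  have hvq : (Walk.cons hwv.symm q).IsPath := by
    rw [Walk.cons_isPath_iff]
    refine ⟨hq, fun hv => ?_⟩
    have := hrz v r.start_mem_support (by simp [hv])
    subst this
    exact hzw (hdisj _ hz hv)
  have h1 : (r.reverse.append (Walk.cons hwv.symm q)).IsPath := by
    refine Walk.IsPath.append_of_inter hr.reverse hvq fun x hx hx' => ?_
    rw [Walk.support_cons, List.mem_cons] at hx'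
    rcases hx' with h | h
    · exact h
    · have hx : x ∈ r.support := by simpa using hx
      have := hrz x hx (by simp [h])
      subst this
      exact absurd (hdisj _ hz h) hzw
  refine onCycle_of_mem_path ha hb hab
    ((p.takeUntil z hz).append (r.reverse.append (Walk.cons hwv.symm q))) ?_ ?_ ?_
  · refine Walk.IsPath.append_of_inter (hp.takeUntil hz) h1 fun x hx hx' => ?_
    rw [Walk.mem_support_append_iff, Walk.support_cons, List.mem_cons] at hx'
    have hxv : x ∈ r.support → x = z := fun h => hrz x h (by simp [hsub x hx])
    rcases hx' with h | h | h
    · exact hxv (by simpa using h)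
    · exact hxv (h ▸ r.start_mem_support)
    · exact absurd (hdisj x (hsub x hx) h) fun h' => hwt (h' ▸ hx)
  · intro h
    simp only [Walk.mem_support_append_iff, Walk.support_cons, List.mem_cons,
      Walk.support_reverse, List.mem_reverse, not_or] at h hi
    rcases h with h | h | h | h
    · exact hi.1 (hsub _ h)
    · exact hir h
    · exact hir (h ▸ r.start_mem_support)
    · exact hi.2 h
  · simp

/-- A walk from `v` that avoids `w` ends at a neighbor of `i`. If `w` is adjacent to `i`, it closes
a cycle with the edge from `w` to `v`. Otherwise stop it where it first meets the given cycle or a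
neighbor of `i`, and splice it into that cycle. -/
lemma OnCycle.step {i w v : V} (hw : G.Adj i w ∨ G.OnCycle i w) (hwv : G.Adj w v) (hv : v ≠ i)
    (h : G.AvoidReach w v i) : G.Adj i v ∨ G.OnCycle i v := by
  classical
  obtain ⟨p, hp⟩ := h
  obtain ⟨c, hc, r, hir, hrp⟩ := p.exists_walk_to_neighbor hv
  have hrw : w ∉ r.support := fun h => hp (hrp _ h)
  right
  rcases hw with hw | ⟨a, b, ha, hb, hab, p, q, hpq, hi⟩
  · refine onCycle_of_mem_path hw hc (fun h => hrw (h ▸ r.end_mem_support))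
      (Walk.cons hwv r.bypass) ?_ ?_ ?_
    · rw [Walk.cons_isPath_iff]
      exact ⟨r.bypass_isPath, fun h => hrw (r.support_bypass_subset_support h)⟩
    · rw [Walk.support_cons, List.mem_cons, not_or]
      exact ⟨hw.ne, fun h => hir (r.support_bypass_subset_support h)⟩
    · simp
  obtain ⟨z, hz, s, hs, hsr, hsz⟩ :=
    r.exists_first_hit {x | x ∈ (p.append q).support ∨ G.Adj i x} (Or.inr hc)
  have his : i ∉ s.support := fun h => hir (hsr _ h)
  have hsw : w ∉ s.support := fun h => hrw (hsr _ h)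
  by_cases hzC : z ∈ (p.append q).support
  · rcases (Walk.mem_support_append_iff _ _).1 hzC with h | h
    · exact onCycle_of_split ha hb hab p q hpq hi hwv s hs his hsw
        (fun x hx hx' => hsz x hx (Or.inl hx')) h
    · refine onCycle_of_split hb ha hab.symm q.reverse p.reverse ?_ ?_ hwv s hs his hsw ?_
        (by simpa using h)
      · rw [← Walk.reverse_append]; exact hpq.reverse
      · rw [← Walk.reverse_append]; simpa only [Walk.support_reverse, List.mem_reverse] using hi
      · intro x hx hx'
        rw [← Walk.reverse_append] at hx'
        exact hsz x hx (Or.inl (by simpa only [Walk.support_reverse, List.mem_reverse] using hx'))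
  -- Here `z` is a neighbor of `i` off the old cycle, so the new cycle enters through `z`, runs to
  -- `v` and `w`, and leaves along `q`.
  · have hzN : G.Adj i z := hz.resolve_left hzC
    have hsC : ∀ x ∈ s.support, x ∉ (p.append q).support := by
      intro x hx hx'
      have := hsz x hx (Or.inl hx')
      exact hzC (this ▸ hx')
    have hq : q.IsPath := hpq.of_append_right
    refine onCycle_of_mem_path hzN hb (fun h => hzC (by simp [h]))
      (s.reverse.append (Walk.cons hwv.symm q)) ?_ ?_ ?_
    · refine Walk.IsPath.append_of_inter hs.reverse ?_ ?_
      · rw [Walk.cons_isPath_iff]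
        exact ⟨hq, fun h => hsC v s.start_mem_support (by simp [h])⟩
      · intro x hx hx'
        rw [Walk.support_cons, List.mem_cons] at hx'
        rcases hx' with h | h
        · exact h
        · exact absurd (by simp [h]) (hsC x (by simpa using hx))
    · simp only [Walk.mem_support_append_iff, Walk.support_cons, List.mem_cons,
        Walk.support_reverse, List.mem_reverse, not_or] at hi ⊢
      exact ⟨his, hv.symm, hi.2⟩
    · simp

lemma Walk.IsPath.avoidReach_or {a b : V} {p : G.Walk a b} (hp : p.IsPath) {v c : V}
    (hv : v ∈ p.support) (hc : c ≠ v) : G.AvoidReach c a v ∨ G.AvoidReach c v b := by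
  classical
  by_cases h1 : c ∈ (p.takeUntil v hv).support
  · right
    refine ⟨p.dropUntil v hv, fun h2 => ?_⟩
    have h3 : ((p.takeUntil v hv).append (p.dropUntil v hv)).IsPath := by simpa using hp
    exact h3.ne_of_mem_support_of_append hc h1 h2 rfl
  · exact Or.inl ⟨_, h1⟩

/-- A Menger-type statement, proved by carrying the cycle along a path from `i` to `v` one edge at a
time; `OnCycle.step` applies because no vertex of the path is separated from `i`. -/
lemma Connected.onCycle_of_nonsep (hG : G.Connected) {i v : V} (h : G.Nonsep i v) (hv : v ≠ i) :
    G.Adj i v ∨ G.OnCycle i v := by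
  classical
  have key : ∀ (u : V) (p : G.Walk u i), (∀ x ∈ p.support, G.Nonsep i x) → u ≠ i →
      G.Adj i u ∨ G.OnCycle i u := by
    intro u p
    induction p with
    | nil => exact fun _ h => absurd rfl h
    | cons hadj p ih =>
      rename_i u w t
      intro hx hu
      by_cases hw : w = t
      · subst hw; exact Or.inl hadj.symm
      refine OnCycle.step (ih h hv (fun x hx' => hx x (by simp [hx'])) hw) hadj.symm hu ?_
      exact (hx u (by simp) w hw hadj.ne').symm
  obtain ⟨p⟩ := hG.preconnected v i
  refine key v p.bypass (fun x hx c hci hcx => ?_) hv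
  -- A vertex `c` occurs at most once on a path, so it misses the segment from `v` to `x` or the one
  -- from `x` to `i`.
  rcases p.bypass_isPath.avoidReach_or hx hcx with h1 | h1
  · exact (h c hci h1.ne_left).trans h1
  · exact h1.symm

end SimpleGraph

/-! ### Neighborhoods as sets of non-separated vertices. -/

namespace TensorNetwork

variable {V E X : Type*} [Fintype V] [Fintype E] [Fintype X]

omit [Fintype E] [Fintype X] in
lemma mem_nbhd (N : TensorNetwork V E X) {ℓ : ℕ} (hconn : N.graph.Connected)
    (hloops : N.LoopsBounded ℓ) {i v : V} : v ∈ N.nbhd ℓ i ↔ N.graph.Nonsep i v := by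
  classical
  simp only [nbhd, Finset.mem_filter, Finset.mem_univ, true_and]
  constructor
  · rintro (rfl | h | ⟨a, b, ha, hb, -, p, hp, -, hv⟩)
    · exact SimpleGraph.Nonsep.refl _
    · exact SimpleGraph.Nonsep.of_adj h
    · intro c hci hcv
      rcases hp.avoidReach_or hv hcv with h | h
      · exact (SimpleGraph.AvoidReach.of_adj ha hci h.ne_left).trans h
      · exact (SimpleGraph.AvoidReach.of_adj hb hci h.ne_right).trans h.symm
  · intro h
    by_cases hv : v = i
    · exact Or.inl hv
    right
    rcases hconn.onCycle_of_nonsep h hv with h | ⟨a, b, ha, hb, hab, p, q, hpq, hi⟩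
    · exact Or.inl h
    refine Or.inr ⟨a, b, ha, hb, hab, p.append q, hpq, ?_, by simp⟩
    -- Closing the path through `i` gives a cycle that is two edges longer, so the loop bound also
    -- bounds the path.
    have hcyc : (SimpleGraph.Walk.cons ha ((p.append q).concat hb.symm)).IsCycle := by
      rw [SimpleGraph.Walk.cons_isCycle_iff]
      refine ⟨hpq.concat hi _, fun he => ?_⟩
      rw [SimpleGraph.Walk.edges_concat, List.concat_eq_append, List.mem_append] at he
      rcases he with he | he
      · exact hi (SimpleGraph.Walk.fst_mem_support_of_mem_edges _ he)
      · rw [List.mem_singleton, Sym2.eq_iff] at he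
        rcases he with ⟨h1, -⟩ | ⟨-, h1⟩
        · exact hb.ne h1
        · exact hab h1
    have := hloops _ _ hcyc
    simp only [SimpleGraph.Walk.length_cons, SimpleGraph.Walk.length_concat] at this
    omega

end TensorNetwork

/-! ### Branches at a cut vertex and the partitions they form. -/

namespace SimpleGraph

variable {V : Type*} {G : SimpleGraph V}

/-- A vertex `c` differs from at least one of `i` and `j`, and that one links `k` to `l` around `c`.
Thus two distinct vertices determine their block. -/
lemma Nonsep.of_common {i j k l : V} (hij : i ≠ j) (hik : G.Nonsep i k) (hjk : G.Nonsep j k)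
    (hil : G.Nonsep i l) (hjl : G.Nonsep j l) : G.Nonsep k l := by
  intro c hck hcl
  by_cases hci : c = i
  · have hcj : c ≠ j := hci ▸ hij
    exact (hjk c hcj hck).symm.trans (hjl c hcj hcl)
  · exact (hik c hci hck).symm.trans (hil c hci hcl)

variable [Fintype V]

open scoped Classical in
/-- The vertices other than `k` that `k` separates from `i`; empty if `i = k`. -/
noncomputable def branch (G : SimpleGraph V) (k i : V) : Finset V :=
  Finset.univ.filter fun v => v ≠ k ∧ i ≠ k ∧ ¬ G.AvoidReach k i v

lemma mem_branch {k i v : V} : v ∈ G.branch k i ↔ v ≠ k ∧ i ≠ k ∧ ¬ G.AvoidReach k i v := by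
  simp [branch]

lemma notMem_branch_self (k i : V) : k ∉ G.branch k i := fun h => (mem_branch.1 h).1 rfl

lemma branch_self (k : V) : G.branch k k = ∅ := by
  ext v
  simp [mem_branch]

/-- The vertex `v` is `k` or separated by `k` from `i`. -/
def InBranch (G : SimpleGraph V) (k i v : V) : Prop := v = k ∨ v ∈ G.branch k i

lemma inBranch_iff {k i v : V} (h : i ≠ k) : G.InBranch k i v ↔ ¬ G.AvoidReach k i v := by
  unfold InBranch
  rw [mem_branch]
  constructor
  · rintro (rfl | h')
    · exact fun h' => h'.ne_right rfl
    · exact h'.2.2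
  · intro h'
    by_cases hv : v = k
    · exact Or.inl hv
    · exact Or.inr ⟨hv, h, h'⟩

lemma inBranch_self_iff {k v : V} : G.InBranch k k v ↔ v = k := by
  simp [InBranch, branch_self]

/-- The set `U` is the disjoint union of the sets consisting of `k` and of the vertices separated
by `k` from `τ k`, where `k` ranges over `K`. -/
structure IsBranchCover (G : SimpleGraph V) (K : Finset V) (τ : V → V) (U : Finset V) : Prop where
  mem_iff : ∀ v, v ∈ U ↔ ∃ k ∈ K, G.InBranch k (τ k) v
  unique : ∀ k ∈ K, ∀ l ∈ K, ∀ v, G.InBranch k (τ k) v → G.InBranch l (τ l) v → k = l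

lemma IsBranchCover.notMem_branch {K U : Finset V} {τ : V → V} (h : G.IsBranchCover K τ U) {k l : V}
    (hk : k ∈ K) (hl : l ∈ K) : l ∉ G.branch k (τ k) := by
  intro hlk
  have := h.unique k hk l hl l (Or.inr hlk) (Or.inl rfl)
  subst this
  exact notMem_branch_self _ _ hlk

lemma IsBranchCover.sum_card {K U : Finset V} {τ : V → V} (h : G.IsBranchCover K τ U) :
    ∑ k ∈ K, ((G.branch k (τ k)).card + 1) = U.card := by
  classical
  have hU : U = K.biUnion fun k => insert k (G.branch k (τ k)) := by
    ext v
    rw [h.mem_iff]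
    simp [InBranch]
  rw [hU, Finset.card_biUnion]
  · exact Finset.sum_congr rfl fun k _ =>
      (Finset.card_insert_of_notMem (notMem_branch_self _ _)).symm
  · intro k hk l hl hkl
    rw [Function.onFun, Finset.disjoint_left]
    intro v hv hv'
    exact hkl (h.unique k hk l hl v (Finset.mem_insert.1 hv) (Finset.mem_insert.1 hv'))

lemma branch_congr {k i i' : V} (hi : i ≠ k) (hi' : i' ≠ k) (h : G.Nonsep i i') :
    G.branch k i = G.branch k i' := by
  have hA := h k hi.symm hi'.symm
  ext v
  simp only [mem_branch]
  refine and_congr_right fun _ => ?_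
  simp only [ne_eq, hi, hi', not_false_eq_true, true_and]
  exact not_congr ⟨hA.symm.trans, hA.trans⟩

section Cover

variable {S : V → Finset V} (hG : G.Connected) (hS : ∀ i v, v ∈ S i ↔ G.Nonsep i v)

include hG in
-- Take the separator of `i` from `v` nearest to `i`, with `v` itself admitted. Nearest means that
-- it has the fewest separators from `i`; anything separating it from `i` would have fewer still.
lemma exists_nonsep_inBranch (i v : V) : ∃ k, G.Nonsep i k ∧ G.InBranch k i v := by
  classical
  by_cases hv : v = i
  · exact ⟨i, Nonsep.refl i, inBranch_self_iff.2 hv⟩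
  let C : V → Finset V := fun c => Finset.univ.filter fun d => d ≠ i ∧ ¬ G.AvoidReach d i c
  have hC : ∀ c d, d ∈ C c ↔ d ≠ i ∧ ¬ G.AvoidReach d i c := by simp [C]
  obtain ⟨c, hc, hmin⟩ := Finset.exists_min_image (C v) (fun c => (C c).card)
    ⟨v, (hC _ _).2 ⟨hv, fun h => h.ne_right rfl⟩⟩
  rw [hC] at hc
  refine ⟨c, fun d hdi hdc => ?_, (inBranch_iff hc.1.symm).2 hc.2⟩
  by_contra hd
  have hdv : d ∈ C v := (hC _ _).2 ⟨hdi, fun h => (h.or_of_between c).elim hd hc.2⟩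
  refine absurd (hmin d hdv) (not_le.2 (Finset.card_lt_card (Finset.ssubset_iff_subset_ne.2
    ⟨fun a ha => ?_, fun heq => ?_⟩)))
  · rw [hC] at ha ⊢
    exact ⟨ha.1, fun h => (h.or_of_between d).elim ha.2 hd⟩
  · have hcc : c ∈ C c := (hC _ _).2 ⟨hc.1, fun h => h.ne_right rfl⟩
    rw [← heq, hC] at hcc
    rcases hG.avoidReach_or hdc i with h | h
    · exact hd h.symm
    · exact hcc.2 h.symm

include hG hS in
-- For disjointness: of two distinct roots, one reaches `v` while avoiding the other. As the avoided
-- one does not separate it from `i`, it does not separate `v` from `i` either.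
lemma isBranchCover_nbhd (i : V) : G.IsBranchCover (S i) (fun _ => i) Finset.univ := by
  refine ⟨fun v => ?_, fun k hk l hl v hkv hlv => ?_⟩
  · obtain ⟨k, hk, hv⟩ := exists_nonsep_inBranch hG i v
    simp only [Finset.mem_univ, true_iff]
    exact ⟨k, (hS _ _).2 hk, hv⟩
  · rw [hS] at hk hl
    have hself : ∀ m, G.InBranch m i i → m = i := by
      intro m hm
      by_contra hmi
      exact (inBranch_iff (Ne.symm hmi)).1 hm (AvoidReach.refl hmi)
    by_cases hki : k = i
    · subst hki
      rw [inBranch_self_iff.1 hkv] at hlv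
      exact (hself l hlv).symm
    by_cases hli : l = i
    · subst hli
      rw [inBranch_self_iff.1 hlv] at hkv
      exact hself k hkv
    rw [inBranch_iff (Ne.symm hki)] at hkv
    rw [inBranch_iff (Ne.symm hli)] at hlv
    by_contra hkl
    rcases hG.avoidReach_or hkl v with h | h
    · exact hkv ((hl k hki hkl).trans h)
    · exact hlv ((hk l hli (Ne.symm hkl)).trans h)

include hG hS in
lemma isBranchCover_nbhdDiff [DecidableEq V] {i j : V} (hj : j ∈ S i) :
    G.IsBranchCover (S i \ S j) (fun _ => i) (G.branch i j) := by
  refine ⟨fun v => ?_, fun k hk l hl => (isBranchCover_nbhd hG hS i).unique k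
    (Finset.mem_sdiff.1 hk).1 l (Finset.mem_sdiff.1 hl).1⟩
  by_cases hji : j = i
  · subst hji
    simp [branch_self]
  rw [hS] at hj
  have hA : ∀ k, k ≠ i → ¬ G.AvoidReach k i v → G.AvoidReach i k v := fun k hk h =>
    (hG.avoidReach_or hk v).resolve_left h
  rw [mem_branch]
  constructor
  · rintro ⟨hvi, -, hv⟩
    obtain ⟨k, hk, hkv⟩ := exists_nonsep_inBranch hG i v
    have hki : k ≠ i := by
      rintro rfl
      exact hvi (inBranch_self_iff.1 hkv)
    refine ⟨k, ?_, hkv⟩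
    rw [Finset.mem_sdiff, hS, hS]
    rw [inBranch_iff hki.symm] at hkv
    exact ⟨hk, fun hjk => hv ((hjk i (Ne.symm hji) hki.symm).trans (hA k hki hkv))⟩
  · rintro ⟨k, hk, hkv⟩
    rw [Finset.mem_sdiff, hS, hS] at hk
    have hki : k ≠ i := by
      rintro rfl
      exact hk.2 hj.symm
    rw [inBranch_iff hki.symm] at hkv
    refine ⟨?_, hji, fun hv => ?_⟩
    · rintro rfl
      exact hkv (AvoidReach.refl hki)
    · refine hk.2 fun c hcj hck => ?_
      by_cases hci : c = i
      · subst hci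
        exact hv.trans (hA k hki hkv).symm
      · exact (hj c hci hcj).symm.trans (hk.1 c hci hck)

include hG hS in
-- The measure on which every induction over messages rests: a message depends only on messages out
-- of strictly smaller branches.
lemma card_branch_lt [DecidableEq V] {i j k : V} (hj : j ∈ S i) (hk : k ∈ S i \ S j) :
    (G.branch k i).card < (G.branch i j).card := by
  have h := isBranchCover_nbhdDiff hG hS hj
  refine Finset.card_lt_card (Finset.ssubset_iff_of_subset (fun v hv => ?_) |>.2 ⟨k, ?_, ?_⟩)
  · exact (h.mem_iff v).2 ⟨k, hk, Or.inr hv⟩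
  · exact (h.mem_iff k).2 ⟨k, hk, Or.inl rfl⟩
  · exact notMem_branch_self _ _

include hG hS in
-- Start from the partition belonging to `S j`. The pieces rooted in `S j \ S i` merge into the
-- branch of `j` away from `i`, which is why `pairTarget` sends `j` to `i`.
lemma isBranchCover_nbhdInter [DecidableEq V] {i j : V} (hij : i ≠ j) (hj : j ∈ S i) :
    G.IsBranchCover (S i ∩ S j) (TensorNetwork.pairTarget i j) Finset.univ := by
  have hi : i ∈ S j := (hS _ _).2 ((hS _ _).1 hj).symm
  have h1 := isBranchCover_nbhd hG hS j
  have h2 := isBranchCover_nbhdDiff hG hS hi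
  have hjj : j ∈ S j := (hS _ _).2 (Nonsep.refl j)
  have key : ∀ l ∈ S i ∩ S j, l ≠ j → ∀ v, G.InBranch j i v → ¬ G.InBranch l j v := by
    intro l hl hlj v hv hlv
    rw [Finset.mem_inter] at hl
    rcases hv with rfl | hv
    · exact hlj (h1.unique l hl.2 v hjj v hlv (Or.inl rfl))
    · obtain ⟨k, hk, hkv⟩ := (h2.mem_iff v).1 hv
      rw [Finset.mem_sdiff] at hk
      have := h1.unique l hl.2 k hk.1 v hlv hkv
      exact hk.2 (this ▸ hl.1)
  refine ⟨fun v => ?_, fun k hk l hl v hkv hlv => ?_⟩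
  · simp only [Finset.mem_univ, true_iff]
    obtain ⟨k, hk, hkv⟩ := (h1.mem_iff v).1 (Finset.mem_univ v)
    by_cases hki : k ∈ S i
    · by_cases hkj : k = j
      · subst hkj
        exact ⟨k, Finset.mem_inter.2 ⟨hki, hk⟩, Or.inl (inBranch_self_iff.1 hkv)⟩
      · exact ⟨k, Finset.mem_inter.2 ⟨hki, hk⟩, by simpa [TensorNetwork.pairTarget, hkj] using hkv⟩
    · exact ⟨j, Finset.mem_inter.2 ⟨hj, hjj⟩, Or.inr (by
        simpa [TensorNetwork.pairTarget] using
          (h2.mem_iff v).2 ⟨k, Finset.mem_sdiff.2 ⟨hk, hki⟩, hkv⟩)⟩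
  · by_cases hkj : k = j <;> by_cases hlj : l = j
    · rw [hkj, hlj]
    · subst hkj
      simp only [TensorNetwork.pairTarget, hlj, if_true, if_false] at hkv hlv
      exact absurd hlv (key l hl hlj v hkv)
    · subst hlj
      simp only [TensorNetwork.pairTarget, hkj, if_true, if_false] at hkv hlv
      exact absurd hkv (key k hk hkj v hlv)
    · simp only [TensorNetwork.pairTarget, hkj, hlj, if_false] at hkv hlv
      exact h1.unique k (Finset.mem_inter.1 hk).2 l (Finset.mem_inter.1 hl).2 v hkv hlv

include hS in
omit [Fintype V] in
lemma inter_eq_of_mem [DecidableEq V] {i j a b : V} (hij : i ≠ j) (hab : a ≠ b)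
    (ha : a ∈ S i ∩ S j) (hb : b ∈ S i ∩ S j) : S a ∩ S b = S i ∩ S j := by
  simp only [Finset.mem_inter, hS] at ha hb
  ext x
  simp only [Finset.mem_inter, hS]
  constructor
  · rintro ⟨h1, h2⟩
    exact ⟨Nonsep.of_common hab ha.1.symm hb.1.symm h1 h2,
      Nonsep.of_common hab ha.2.symm hb.2.symm h1 h2⟩
  · rintro ⟨h1, h2⟩
    exact ⟨Nonsep.of_common hij ha.1 ha.2 h1 h2, Nonsep.of_common hij hb.1 hb.2 h1 h2⟩

include hS in
omit [Fintype V] in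
lemma sdiff_congr [DecidableEq V] {k i i' : V} (hi : i ≠ k) (hi' : i' ≠ k) (h : i ∈ S k)
    (h' : i' ∈ S k) (h'' : i' ∈ S i) : S k \ S i = S k \ S i' := by
  rw [hS] at h h' h''
  ext v
  simp only [Finset.mem_sdiff, hS]
  refine and_congr_right fun hv => not_congr ⟨fun hiv => ?_, fun hiv => ?_⟩
  · exact Nonsep.of_common hi h'' h' hiv hv
  · exact Nonsep.of_common hi' h''.symm h hiv hv

end Cover

end SimpleGraph

/-! ### Counting pairs block by block. -/

namespace SimpleGraph

variable {V : Type*} [Fintype V] {G : SimpleGraph V} {S : V → Finset V}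

/-- `P` lists every unordered pair of distinct vertices with `j ∈ S i` once, in one order. -/
structure IsPairSelection (S : V → Finset V) (P : Finset (V × V)) : Prop where
  ne : ∀ q ∈ P, q.1 ≠ q.2
  mem : ∀ q ∈ P, q.2 ∈ S q.1
  iff_notMem : ∀ i j, i ≠ j → j ∈ S i → ((i, j) ∈ P ↔ (j, i) ∉ P)

section

variable [DecidableEq V] (hS : ∀ i v, v ∈ S i ↔ G.Nonsep i v)

include hS

omit [Fintype V] [DecidableEq V] in
lemma self_mem_of_nonsep (i : V) : i ∈ S i := (hS i i).2 (Nonsep.refl i)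

omit [Fintype V] in
lemma left_mem_inter {i j : V} (hj : j ∈ S i) : i ∈ S i ∩ S j :=
  Finset.mem_inter.2 ⟨self_mem_of_nonsep hS i, (hS _ _).2 ((hS _ _).1 hj).symm⟩

omit [Fintype V] in
lemma right_mem_inter {i j : V} (hj : j ∈ S i) : j ∈ S i ∩ S j :=
  Finset.mem_inter.2 ⟨hj, self_mem_of_nonsep hS j⟩

omit [Fintype V] in
lemma mem_of_mem_inter {i j a b : V} (hij : i ≠ j) (ha : a ∈ S i ∩ S j) (hb : b ∈ S i ∩ S j) :
    b ∈ S a := by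
  simp only [Finset.mem_inter, hS] at ha hb ⊢
  exact Nonsep.of_common hij ha.1 ha.2 hb.1 hb.2

omit [Fintype V] in
lemma inter_eq_iff {i j a b : V} (hij : i ≠ j) :
    (a ≠ b ∧ b ∈ S a) ∧ S a ∩ S b = S i ∩ S j ↔
      (a ∈ S i ∩ S j ∧ b ∈ S i ∩ S j) ∧ a ≠ b := by
  constructor
  · rintro ⟨⟨hab, hb⟩, h⟩
    exact ⟨⟨h ▸ left_mem_inter hS hb, h ▸ right_mem_inter hS hb⟩, hab⟩
  · rintro ⟨⟨ha, hb⟩, hab⟩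
    exact ⟨⟨hab, mem_of_mem_inter hS hij ha hb⟩, inter_eq_of_mem hS hij hab ha hb⟩

omit [Fintype V] in
-- The ordered pairs of distinct vertices of a block split into the selected pairs and their swaps.
lemma two_mul_card_filter {P : Finset (V × V)} (hP : IsPairSelection S P) {i j : V}
    (hij : i ≠ j) :
    2 * (P.filter fun q => S q.1 ∩ S q.2 = S i ∩ S j).card =
      (S i ∩ S j).card * ((S i ∩ S j).card - 1) := by
  set F := P.filter fun q => S q.1 ∩ S q.2 = S i ∩ S j with hF
  have hoff : (S i ∩ S j).offDiag = F ∪ F.image Prod.swap := by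
    ext ⟨a, b⟩
    simp only [Finset.mem_offDiag, Finset.mem_union, Finset.mem_image, hF, Finset.mem_filter,
      Prod.exists, Prod.swap_prod_mk, Prod.mk.injEq]
    have h1 := inter_eq_iff (a := a) (b := b) hS hij
    constructor
    · rintro ⟨ha, hb, hab⟩
      obtain ⟨⟨-, hba⟩, heq⟩ := h1.2 ⟨⟨ha, hb⟩, hab⟩
      by_cases hm : (a, b) ∈ P
      · exact Or.inl ⟨hm, heq⟩
      · have : (b, a) ∈ P := by
          by_contra h
          exact hm ((hP.iff_notMem a b hab hba).2 h)
        exact Or.inr ⟨b, a, ⟨this, by rw [Finset.inter_comm, heq]⟩, rfl, rfl⟩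
    · rintro (⟨hm, heq⟩ | ⟨b', a', ⟨hm, heq⟩, rfl, rfl⟩)
      · have := h1.1 ⟨⟨hP.ne _ hm, hP.mem _ hm⟩, heq⟩
        exact ⟨this.1.1, this.1.2, this.2⟩
      · have := (inter_eq_iff hS hij).1 ⟨⟨hP.ne _ hm, hP.mem _ hm⟩, heq⟩
        exact ⟨this.1.2, this.1.1, this.2.symm⟩
  have hdisj : Disjoint F (F.image Prod.swap) := by
    rw [Finset.disjoint_left]
    rintro ⟨a, b⟩ h1 h2
    rw [Finset.mem_image] at h2
    obtain ⟨⟨b', a'⟩, h2, h3⟩ := h2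
    simp only [Prod.swap_prod_mk, Prod.mk.injEq] at h3
    obtain ⟨rfl, rfl⟩ := h3
    have h1 := (Finset.mem_filter.1 h1).1
    exact (hP.iff_notMem _ _ (hP.ne _ h1) (hP.mem _ h1)).1 h1 (Finset.mem_filter.1 h2).1
  have hcard := congrArg Finset.card hoff
  rw [Finset.card_union_of_disjoint hdisj, Finset.card_image_of_injective _ Prod.swap_injective,
    Finset.offDiag_card] at hcard
  rw [Nat.mul_sub_one]
  omega

/-- A product over vertices and their neighborhoods of factors that depend on the block only is
a product over blocks. -/
lemma prod_prod_eq_mul_prod_rpow {P : Finset (V × V)} (hP : IsPairSelection S P)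
    (f : V → V → ℝ) (hf0 : ∀ k i, 0 ≤ f k i)
    (hf : ∀ k i i', i ≠ k → i' ≠ k → i ∈ S k → i' ∈ S k → i' ∈ S i → f k i = f k i') :
    ∏ i, ∏ k ∈ S i, f k i = (∏ i, f i i) *
      ∏ q ∈ P, (∏ k ∈ S q.1 ∩ S q.2, f k (TensorNetwork.pairTarget q.1 q.2 k)) ^
        (2 / ((S q.1 ∩ S q.2).card : ℝ)) := by
  set Q : Finset (V × V) := Finset.univ.filter fun q => q.1 ≠ q.2 ∧ q.2 ∈ S q.1 with hQ
  set blk : V × V → Finset V := fun q => S q.1 ∩ S q.2 with hblk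
  set w : V × V → ℝ := fun q =>
    ∏ k ∈ S q.1 ∩ S q.2, f k (TensorNetwork.pairTarget q.1 q.2 k) with hw
  have hsymm : ∀ {i j}, j ∈ S i → i ∈ S j := fun h => (hS _ _).2 ((hS _ _).1 h).symm
  have hleft : ∏ i, ∏ k ∈ S i, f k i = (∏ i, f i i) * ∏ q ∈ Q, f q.2 q.1 := by
    have : ∏ q ∈ Q, f q.2 q.1 = ∏ i, ∏ k ∈ (S i).erase i, f k i := by
      rw [Finset.prod_sigma']
      refine Finset.prod_bij' (fun q _ => ⟨q.1, q.2⟩) (fun q _ => (q.1, q.2)) ?_ ?_ ?_ ?_ ?_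
      · intro q hq
        simp only [hQ, Finset.mem_filter] at hq
        simp [hq.2.1.symm, hq.2.2]
      · rintro ⟨a, b⟩ hq
        simp only [Finset.mem_sigma, Finset.mem_erase] at hq
        simp [hQ, hq.2.1.symm, hq.2.2]
      · intros; rfl
      · intros; rfl
      · intros; rfl
    rw [this, ← Finset.prod_mul_distrib]
    exact Finset.prod_congr rfl fun i _ =>
      (Finset.mul_prod_erase _ (fun k => f k i) (self_mem_of_nonsep hS i)).symm
  have hmapsQ : ∀ q ∈ Q, blk q ∈ Q.image blk := fun q hq => Finset.mem_image_of_mem _ hq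
  have hmapsP : ∀ q ∈ P, blk q ∈ Q.image blk := fun q hq =>
    Finset.mem_image_of_mem _ (by simp [hQ, hP.ne q hq, hP.mem q hq])
  -- Within a block the factor at `k` is the same for every target other than `k`, whichever pair
  -- represents the block.
  have hwc : ∀ i j, i ≠ j → j ∈ S i → ∀ a b, a ≠ b → b ∈ S a → S a ∩ S b = S i ∩ S j →
      ∀ k ∈ S i ∩ S j, ∀ l ∈ S i ∩ S j, l ≠ k → f k l = f k (TensorNetwork.pairTarget a b k) := by
    intro i j hij hj a b hab hb heq k hk l hl hlk
    obtain ⟨⟨ha', hb'⟩, -⟩ := (inter_eq_iff hS hij).1 ⟨⟨hab, hb⟩, heq⟩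
    have ht : TensorNetwork.pairTarget a b k ≠ k ∧
        TensorNetwork.pairTarget a b k ∈ S i ∩ S j := by
      unfold TensorNetwork.pairTarget
      split_ifs with h
      · exact ⟨h ▸ hab, ha'⟩
      · exact ⟨Ne.symm h, hb'⟩
    exact hf k l _ hlk ht.1 (mem_of_mem_inter hS hij hk hl) (mem_of_mem_inter hS hij hk ht.2)
      (mem_of_mem_inter hS hij hl ht.2)
  have hne : ∀ a b k : V, a ≠ b → TensorNetwork.pairTarget a b k ≠ k := by
    intro a b k hab
    unfold TensorNetwork.pairTarget
    split_ifs with h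
    · exact h ▸ hab
    · exact Ne.symm h
  have htm : ∀ i j k : V, j ∈ S i → TensorNetwork.pairTarget i j k ∈ S i ∩ S j := by
    intro i j k hj
    unfold TensorNetwork.pairTarget
    split_ifs with h
    · exact left_mem_inter hS hj
    · exact right_mem_inter hS hj
  rw [hleft]
  congr 1
  rw [← Finset.prod_fiberwise_of_maps_to hmapsQ, ← Finset.prod_fiberwise_of_maps_to hmapsP]
  refine Finset.prod_congr rfl fun B hB => ?_
  obtain ⟨⟨i, j⟩, hq, rfl⟩ := Finset.mem_image.1 hB
  simp only [hQ, Finset.mem_filter, Finset.mem_univ, true_and] at hq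
  obtain ⟨hij, hj⟩ := hq
  have hfib : (Q.filter fun q => blk q = blk (i, j)) = (S i ∩ S j).offDiag := by
    ext ⟨a, b⟩
    have := inter_eq_iff (a := a) (b := b) hS hij
    simp only [hQ, hblk, Finset.mem_filter, Finset.mem_univ, true_and, Finset.mem_offDiag]
    tauto
  set n := (S i ∩ S j).card with hn
  have hn1 : 1 ≤ n := Finset.card_pos.2 ⟨i, left_mem_inter hS hj⟩
  have h1 : ∏ q ∈ Q.filter (fun q => blk q = blk (i, j)), f q.2 q.1 = w (i, j) ^ (n - 1) := by
    rw [hfib]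
    have : ∏ q ∈ (S i ∩ S j).offDiag, f q.2 q.1 =
        ∏ k ∈ S i ∩ S j, ∏ l ∈ (S i ∩ S j).erase k, f k l := by
      rw [Finset.prod_sigma']
      refine Finset.prod_bij' (fun q _ => ⟨q.2, q.1⟩) (fun q _ => (q.2, q.1)) ?_ ?_ ?_ ?_ ?_
      · intro q hq
        rw [Finset.mem_offDiag] at hq
        simp [hq.2.2, Finset.mem_inter.1 hq.1, Finset.mem_inter.1 hq.2.1]
      · rintro ⟨a, b⟩ hq
        simp only [Finset.mem_sigma, Finset.mem_erase] at hq
        exact Finset.mem_offDiag.2 ⟨hq.2.2, hq.1, hq.2.1⟩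
      · intros; rfl
      · intros; rfl
      · intros; rfl
    rw [this, hw, ← Finset.prod_pow]
    refine Finset.prod_congr rfl fun k hk => ?_
    rw [Finset.prod_congr rfl fun l hl => hwc i j hij hj i j hij hj rfl k hk l
      (Finset.mem_of_mem_erase hl) (Finset.ne_of_mem_erase hl), Finset.prod_const,
      Finset.card_erase_of_mem hk]
  have h2 : ∀ q ∈ P.filter (fun q => blk q = blk (i, j)),
      w q ^ (2 / ((S q.1 ∩ S q.2).card : ℝ)) = w (i, j) ^ (2 / (n : ℝ)) := by
    rintro ⟨a, b⟩ hq
    rw [Finset.mem_filter] at hq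
    obtain ⟨hqP, heq⟩ := hq
    change S a ∩ S b = S i ∩ S j at heq
    have hab : a ≠ b := hP.ne _ hqP
    have hb : b ∈ S a := hP.mem _ hqP
    have : w (a, b) = w (i, j) := by
      simp only [hw, heq]
      refine Finset.prod_congr rfl fun k hk => ?_
      exact (hwc i j hij hj a b hab hb heq k hk _ (htm i j k hj) (hne i j k hij)).symm
    rw [this]
    simp only [heq, hn]
  rw [h1, Finset.prod_congr rfl h2, Finset.prod_const]
  have hw0 : 0 ≤ w (i, j) := Finset.prod_nonneg fun k _ => hf0 _ _
  rw [← Real.rpow_natCast, ← Real.rpow_natCast, ← Real.rpow_mul hw0]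
  congr 1
  -- Exponents agree: `n (n - 1) / 2` selected pairs, each with exponent `2 / n`, amount to `n - 1`.
  have hc := two_mul_card_filter hS hP hij
  rw [← hn] at hc
  have hc' : (2 : ℝ) * (P.filter fun q => blk q = blk (i, j)).card = n * ((n - 1 : ℕ) : ℝ) := by
    exact_mod_cast hc
  have hn0 : (n : ℝ) ≠ 0 := by positivity
  field_simp
  linarith

/-- This encodes the sum of the exponents without a separate count of blocks. Give every vertex the
weight `d`, the `|V|`-th root of `c`, and let `f k i` be the weight of `k` with its branch; every
partition of the graph then has total weight `c`, as does the diagonal. -/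
lemma mul_prod_rpow_eq_pow_card (hG : G.Connected) {P : Finset (V × V)}
    (hP : IsPairSelection S P) {c : ℝ} (hc : 0 ≤ c) :
    c * ∏ q ∈ P, c ^ (2 / ((S q.1 ∩ S q.2).card : ℝ)) = c ^ Fintype.card V := by
  have : Nonempty V := hG.nonempty
  have hV : (Fintype.card V : ℝ) ≠ 0 := by exact_mod_cast Fintype.card_ne_zero
  set d : ℝ := c ^ (1 / (Fintype.card V : ℝ)) with hd
  have hd0 : 0 ≤ d := Real.rpow_nonneg hc _
  have hdc : d ^ Fintype.card V = c := by
    rw [hd, ← Real.rpow_natCast, ← Real.rpow_mul hc, one_div_mul_cancel hV, Real.rpow_one]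
  have hcov : ∀ {K : Finset V} {τ : V → V}, G.IsBranchCover K τ Finset.univ →
      ∏ k ∈ K, d ^ ((G.branch k (τ k)).card + 1) = c := by
    intro K τ h
    rw [Finset.prod_pow_eq_pow_sum, h.sum_card, Finset.card_univ, hdc]
  have key := prod_prod_eq_mul_prod_rpow hS hP (fun k i => d ^ ((G.branch k i).card + 1))
    (fun _ _ => pow_nonneg hd0 _) (fun k i i' hi hi' _ _ h => by
      simp only [branch_congr hi hi' ((hS _ _).1 h)])
  rw [Finset.prod_congr rfl fun i _ => hcov (isBranchCover_nbhd hG hS i)] at key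
  rw [Finset.prod_congr rfl fun q hq => by
    rw [← hcov (isBranchCover_nbhdInter hG hS (hP.ne q hq) (hP.mem q hq))]]
  simp only [branch_self, Finset.card_empty, zero_add, pow_one, Finset.prod_const,
    Finset.card_univ, hdc] at key
  exact key.symm

end

end SimpleGraph

/-! ### Partial traces and the factorization of contractions. -/

namespace TensorNetwork

section PartialTrace

variable {E X : Type*} [Fintype E] [Fintype X]

open scoped Classical in
/-- The sum of `f` over the variables in `C`, all other variables being kept as in `x`. -/
noncomputable def partialTrace (C : Finset E) (f : (E → X) → ℝ) (x : E → X) : ℝ :=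
  ∑ z : E → X with ∀ e, e ∉ C → z e = x e, f z

lemma partialTrace_union [DecidableEq E] {A B : Finset E} (h : Disjoint A B) (f : (E → X) → ℝ)
    (x : E → X) : partialTrace (A ∪ B) f x = partialTrace A (partialTrace B f) x := by
  classical
  unfold partialTrace
  rw [← Finset.sum_fiberwise_of_maps_to
    (t := Finset.univ.filter fun w : E → X => ∀ e, e ∉ A → w e = x e)
    -- Group the configurations by the intermediate one that agrees with `z` on `A` and with `x`
    -- elsewhere.
    (g := fun (z : E → X) (e : E) => if e ∈ A then z e else x e)]
  · refine Finset.sum_congr (by ext; simp) fun w hw => Finset.sum_congr ?_ fun _ _ => rfl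
    simp only [Finset.mem_filter, Finset.mem_univ, true_and] at hw
    ext z
    simp only [Finset.mem_filter, Finset.mem_univ, true_and, Finset.mem_union, not_or]
    constructor
    · rintro ⟨h1, h2⟩ e he
      by_cases heA : e ∈ A
      · rw [← h2]
        exact (if_pos heA).symm
      · rw [h1 e ⟨heA, he⟩, hw e heA]
    · intro h1
      refine ⟨fun e he => by rw [h1 e he.2, hw e he.1], funext fun e => ?_⟩
      split_ifs with heA
      · exact h1 e (Finset.disjoint_left.1 h heA)
      · exact (hw e heA).symm
  · intro z _
    simp only [Finset.mem_filter, Finset.mem_univ, true_and]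
    intro e he
    rw [if_neg he]

lemma partialTrace_empty (f : (E → X) → ℝ) (x : E → X) : partialTrace ∅ f x = f x := by
  classical
  unfold partialTrace
  refine Finset.sum_eq_single_of_mem x (by simp) fun z hz hzx => ?_
  rw [Finset.mem_filter] at hz
  exact absurd (funext fun e => hz.2 e (Finset.notMem_empty e)) hzx

lemma partialTrace_mul_left {C : Finset E} {g : (E → X) → ℝ} (hg : DependsOn g (C : Set E)ᶜ)
    (f : (E → X) → ℝ) (x : E → X) :
    partialTrace C (fun z => g z * f z) x = g x * partialTrace C f x := by
  classical
  unfold partialTrace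
  rw [Finset.mul_sum]
  refine Finset.sum_congr rfl fun z hz => ?_
  rw [Finset.mem_filter] at hz
  exact congrArg (· * f z) (hg fun e he => hz.2 e (by simpa using he))

lemma partialTrace_congr (C : Finset E) {f g : (E → X) → ℝ} (h : ∀ z, f z = g z) (x : E → X) :
    partialTrace C f x = partialTrace C g x := by
  rw [funext h]

lemma dependsOn_partialTrace {C : Finset E} {f : (E → X) → ℝ} {s : Set E} (hf : DependsOn f s) :
    DependsOn (partialTrace C f) s := by
  classical
  intro x x' hx
  unfold partialTrace
  refine Finset.sum_bij' (fun z _ e => if e ∈ C then z e else x' e)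
    (fun z _ e => if e ∈ C then z e else x e) ?_ ?_ ?_ ?_ ?_
  · intro z _
    simp +contextual
  · intro z _
    simp +contextual
  · intro z hz
    simp only [Finset.mem_filter, Finset.mem_univ, true_and] at hz
    funext e
    by_cases he : e ∈ C
    · simp [he]
    · simp [he, hz e he]
  · intro z hz
    simp only [Finset.mem_filter, Finset.mem_univ, true_and] at hz
    funext e
    by_cases he : e ∈ C
    · simp [he]
    · simp [he, hz e he]
  · intro z hz
    simp only [Finset.mem_filter, Finset.mem_univ, true_and] at hz
    refine hf fun e he => ?_
    by_cases heC : e ∈ C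
    · simp [heC]
    · simp [heC, hz e heC, hx e he]

/-- The distributive law: each summed variable occurs in a single factor. -/
lemma partialTrace_prod {ι : Type*} [DecidableEq ι] [DecidableEq E] (K : Finset ι)
    (A : ι → Finset E) (f : ι → (E → X) → ℝ)
    (hA : ∀ k ∈ K, ∀ l ∈ K, k ≠ l → Disjoint (A k) (A l))
    (hf : ∀ k ∈ K, ∀ l ∈ K, k ≠ l → DependsOn (f k) (A l : Set E)ᶜ) (x : E → X) :
    partialTrace (K.biUnion A) (fun z => ∏ k ∈ K, f k z) x =
      ∏ k ∈ K, partialTrace (A k) (f k) x := by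
  classical
  induction K using Finset.induction_on generalizing x with
  | empty => simp [partialTrace_empty]
  | insert a K ha ih =>
    have hne : ∀ k ∈ K, a ≠ k := fun k hk h => ha (h ▸ hk)
    have hmem : ∀ k ∈ K, k ∈ insert a K := fun k => Finset.mem_insert_of_mem
    have hdisj : Disjoint (A a) (K.biUnion A) :=
      (Finset.disjoint_biUnion_right _ _ _).2 fun k hk =>
        hA a (Finset.mem_insert_self _ _) k (hmem k hk) (hne k hk)
    have hK : ∀ z, partialTrace (K.biUnion A) (fun z => ∏ k ∈ insert a K, f k z) z =
        (∏ k ∈ K, partialTrace (A k) (f k) z) * f a z := by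
      intro z
      rw [partialTrace_congr _ (fun z => Finset.prod_insert ha), partialTrace_mul_left, ih, mul_comm]
      · exact fun k hk l hl => hA k (hmem k hk) l (hmem l hl)
      · exact fun k hk l hl => hf k (hmem k hk) l (hmem l hl)
      · intro z z' hz
        have hz' : ∀ e, (∀ k ∈ K, e ∉ A k) → z e = z' e := fun e he => hz e (by simpa using he)
        by_contra hcon
        -- Independence of each `A k` separately gives independence of their union by changing one
        -- `A b` at a time.
        have key : ∀ L : Finset ι, L ⊆ K → ∀ w : E → X,
            (∀ e, (∀ k ∈ L, e ∉ A k) → z e = w e) → f a z = f a w := by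
          intro L
          induction L using Finset.induction_on with
          | empty =>
            intro _ w hw
            rw [funext fun e => hw e (by simp)]
          | insert b L hb ih' =>
            intro hL w hw
            rw [Finset.insert_subset_iff] at hL
            have h1 := ih' hL.2 (fun e => if e ∈ A b then z e else w e) (fun e he => by
              by_cases heb : e ∈ A b
              · simp [heb]
              · simp only [heb, if_false]
                exact hw e (by simpa [heb] using he))
            rw [h1]
            refine hf a (Finset.mem_insert_self _ _) b (hmem b hL.1) (hne b hL.1) fun e he => ?_
            have he' : e ∉ A b := by simpa using he
            simp [he']
        exact hcon (key K subset_rfl z' hz')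
    rw [Finset.biUnion_insert, partialTrace_union hdisj, partialTrace_congr _ hK,
      partialTrace_mul_left, Finset.prod_insert ha, mul_comm]
    intro z z' hz
    refine Finset.prod_congr rfl fun k hk => ?_
    exact dependsOn_partialTrace
      (hf k (hmem k hk) a (Finset.mem_insert_self _ _) (hne k hk).symm) hz

open scoped Classical in
-- Moves sums over partial assignments to full configurations, so that contractions over different
-- variable sets can be compared on one type.
lemma sum_restrict_eq_partialTrace {A C : Finset E} (F : (A → X) → ℝ) (x : E → X) :
    ∑ y : A → X with ∀ e : A, e.1 ∈ C → y e = x e, F y =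
      partialTrace (A \ C) (fun z => F fun e => z e) x := by
  unfold partialTrace
  refine Finset.sum_bij' (fun y _ e => if h : e ∈ A then y ⟨e, h⟩ else x e)
    (fun z _ e => z e) ?_ ?_ ?_ ?_ ?_
  · intro y hy
    simp only [Finset.mem_filter, Finset.mem_univ, true_and, Finset.mem_sdiff, not_and,
      not_not] at hy ⊢
    intro e he
    by_cases h : e ∈ A
    · simp [h, hy ⟨e, h⟩ (he h)]
    · simp [h]
  · intro z hz
    simp only [Finset.mem_filter, Finset.mem_univ, true_and, Finset.mem_sdiff, not_and,
      not_not] at hz ⊢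
    exact fun e he => hz e fun _ => he
  · intro y _
    funext e
    simp
  · intro z hz
    simp only [Finset.mem_filter, Finset.mem_univ, true_and, Finset.mem_sdiff, not_and,
      not_not] at hz
    funext e
    by_cases h : e ∈ A
    · simp [h]
    · simp [h, hz e fun h' => absurd h' h]
  · intro y _
    congr 1
    funext e
    simp

end PartialTrace

variable {V E X : Type*} [Fintype V] [Fintype E] [Fintype X]

/-- The value of the tensor `k` on a full configuration. -/
def tensorAt (N : TensorNetwork V E X) (k : V) (x : E → X) : ℝ := N.tensor k fun e => x e

omit [Fintype V] [Fintype E] [Fintype X] in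
lemma tensorAt_dependsOn (N : TensorNetwork V E X) (k : V) :
    DependsOn (N.tensorAt k) {e | k ∈ N.ends e} := fun _ _ h =>
  congrArg (N.tensor k) (funext fun e => h e.1 e.2)

open scoped Classical in
/-- The variables that only tensors in `D` depend on. -/
noncomputable def innerVars (N : TensorNetwork V E X) (D : Finset V) : Finset E :=
  Finset.univ.filter fun e => ∀ k ∈ N.ends e, k ∈ D

omit [Fintype X] in
lemma mem_innerVars (N : TensorNetwork V E X) {D : Finset V} {e : E} :
    e ∈ N.innerVars D ↔ ∀ k ∈ N.ends e, k ∈ D := by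
  simp [innerVars]

omit [Fintype V] [Fintype X] in
lemma mem_vars_iff (N : TensorNetwork V E X) {D : Finset V} {e : E} :
    e ∈ N.vars D ↔ ∃ k ∈ D, k ∈ N.ends e := by
  simp [vars]

omit [Fintype V] [Fintype E] [Fintype X] in
lemma exists_mem_ends (N : TensorNetwork V E X) (e : E) : ∃ k, k ∈ N.ends e :=
  ⟨_, Sym2.out_fst_mem _⟩

omit [Fintype X] in
lemma vars_univ (N : TensorNetwork V E X) : N.vars Finset.univ = Finset.univ := by
  ext e
  simpa [mem_vars_iff] using N.exists_mem_ends e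

omit [Fintype V] [Fintype E] [Fintype X] in
lemma adj_of_mem_ends (N : TensorNetwork V E X) {e : E} {u w : V} (hu : u ∈ N.ends e)
    (hw : w ∈ N.ends e) (h : u ≠ w) : N.graph.Adj u w :=
  ⟨h, e, (Sym2.mem_and_mem_iff h).1 ⟨hu, hw⟩⟩

lemma mem_branch_of_adj {G : SimpleGraph V} {k i u w : V} (hu : u ∈ G.branch k i)
    (h : G.Adj u w) (hw : w ≠ k) : w ∈ G.branch k i := by
  rw [SimpleGraph.mem_branch] at hu ⊢
  exact ⟨hw, hu.2.1, fun h' => hu.2.2 (h'.trans (.of_adj h.symm hw.symm hu.1.symm))⟩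

/-- The full contraction of the tensors that `i` separates from `j`. -/
noncomputable def branchSum (N : TensorNetwork V E X) (i j : V) : (E → X) → ℝ :=
  partialTrace (N.innerVars (N.graph.branch i j)) fun x => ∏ v ∈ N.graph.branch i j, N.tensorAt v x

lemma branchSum_nonneg (N : TensorNetwork V E X) (i j : V) (x : E → X) :
    0 ≤ N.branchSum i j x :=
  Finset.sum_nonneg fun _ _ => Finset.prod_nonneg fun _ _ => N.tensor_nonneg _ _

lemma branchSum_self (N : TensorNetwork V E X) (i : V) (x : E → X) : N.branchSum i i x = 1 := by
  classical
  have h : N.innerVars (N.graph.branch i i) = ∅ := by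
    ext e
    obtain ⟨k, hk⟩ := N.exists_mem_ends e
    simp only [mem_innerVars, SimpleGraph.branch_self, Finset.notMem_empty, iff_false]
    exact fun h => h k hk
  rw [branchSum, h, partialTrace_empty, SimpleGraph.branch_self, Finset.prod_empty]

section Cover

variable [DecidableEq V] [DecidableEq E] (N : TensorNetwork V E X) {K U : Finset V} {τ : V → V}

/-- The inner variables of a branch meet neither its root nor any other piece of the partition, so
the partial trace distributes over the pieces. -/
lemma prod_branchSum (h : N.graph.IsBranchCover K τ U) (x : E → X) :
    ∏ k ∈ K, (N.tensorAt k x * N.branchSum k (τ k) x) =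
      partialTrace (K.biUnion fun k => N.innerVars (N.graph.branch k (τ k)))
        (fun z => ∏ v ∈ U, N.tensorAt v z) x := by
  have hin : ∀ k v, v ∈ insert k (N.graph.branch k (τ k)) ↔ N.graph.InBranch k (τ k) v := by
    simp [SimpleGraph.InBranch]
  have hU : ∀ z, ∏ v ∈ U, N.tensorAt v z =
      ∏ k ∈ K, ∏ v ∈ insert k (N.graph.branch k (τ k)), N.tensorAt v z := by
    intro z
    rw [← Finset.prod_biUnion]
    · refine Finset.prod_congr ?_ fun _ _ => rfl
      ext v
      rw [h.mem_iff, Finset.mem_biUnion]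
      simp only [hin]
    · intro k hk l hl hkl
      rw [Function.onFun, Finset.disjoint_left]
      intro v hv hv'
      rw [hin] at hv hv'
      exact hkl (h.unique k hk l hl v hv hv')
  rw [partialTrace_congr _ hU, partialTrace_prod]
  · refine Finset.prod_congr rfl fun k _ => ?_
    rw [branchSum, ← partialTrace_mul_left]
    · refine partialTrace_congr _ (fun z => ?_) x
      rw [Finset.prod_insert (SimpleGraph.notMem_branch_self _ _)]
    · refine fun z z' hz => N.tensorAt_dependsOn k fun e he => hz e ?_
      simp only [Set.mem_compl_iff, Finset.mem_coe, mem_innerVars]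
      exact fun h' => SimpleGraph.notMem_branch_self _ _ (h' k he)
  · intro k hk l hl hkl
    rw [Finset.disjoint_left]
    intro e he he'
    obtain ⟨v, hv⟩ := N.exists_mem_ends e
    rw [mem_innerVars] at he he'
    exact hkl (h.unique k hk l hl v (Or.inr (he v hv)) (Or.inr (he' v hv)))
  · intro k hk l hl hkl z z' hz
    refine Finset.prod_congr rfl fun v hv => N.tensorAt_dependsOn v fun e he => hz e ?_
    simp only [Set.mem_compl_iff, Finset.mem_coe, mem_innerVars]
    exact fun h' => hkl (h.unique k hk l hl v ((hin _ _).1 hv) (Or.inr (h' v he)))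

omit [DecidableEq V] [Fintype X] in
lemma disjoint_vars_biUnion (h : N.graph.IsBranchCover K τ U) :
    Disjoint (N.vars K) (K.biUnion fun k => N.innerVars (N.graph.branch k (τ k))) := by
  rw [Finset.disjoint_left]
  intro e he he'
  obtain ⟨l, hl, hle⟩ := N.mem_vars_iff.1 he
  obtain ⟨k, hk, hke⟩ := Finset.mem_biUnion.1 he'
  exact h.notMem_branch hk hl (N.mem_innerVars.1 hke l hle)

omit [Fintype X] in
-- A variable that touches the branch of `k` but not `k` itself has all its endpoints in that
-- branch.
lemma vars_union_biUnion (h : N.graph.IsBranchCover K τ U) :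
    N.vars K ∪ (K.biUnion fun k => N.innerVars (N.graph.branch k (τ k))) = N.vars U := by
  ext e
  simp only [Finset.mem_union, Finset.mem_biUnion, mem_vars_iff, mem_innerVars]
  constructor
  · rintro (⟨k, hk, hke⟩ | ⟨k, hk, hke⟩)
    · exact ⟨k, (h.mem_iff k).2 ⟨k, hk, Or.inl rfl⟩, hke⟩
    · obtain ⟨v, hv⟩ := N.exists_mem_ends e
      exact ⟨v, (h.mem_iff v).2 ⟨k, hk, Or.inr (hke v hv)⟩, hv⟩
  · rintro ⟨u, hu, hue⟩
    obtain ⟨k, hk, rfl | huk⟩ := (h.mem_iff u).1 hu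
    · exact Or.inl ⟨u, hk, hue⟩
    by_cases hke : k ∈ N.ends e
    · exact Or.inl ⟨k, hk, hke⟩
    refine Or.inr ⟨k, hk, fun w hw => ?_⟩
    by_cases huw : u = w
    · exact huw ▸ huk
    · exact mem_branch_of_adj huk (N.adj_of_mem_ends hue hw huw) (fun h' => hke (h' ▸ hw))

lemma partialTrace_prod_branchSum (h : N.graph.IsBranchCover K τ U) {C : Finset E}
    (hC : C ⊆ N.vars K) (x : E → X) :
    partialTrace (N.vars K \ C) (fun z => ∏ k ∈ K, (N.tensorAt k z * N.branchSum k (τ k) z)) x =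
      partialTrace (N.vars U \ C) (fun z => ∏ v ∈ U, N.tensorAt v z) x := by
  have hd := N.disjoint_vars_biUnion h
  have hCd := Finset.disjoint_of_subset_left hC hd
  rw [partialTrace_congr _ (N.prod_branchSum h), ← partialTrace_union
    (Finset.disjoint_of_subset_left Finset.sdiff_subset hd), ← N.vars_union_biUnion h,
    Finset.union_sdiff_distrib, Finset.sdiff_eq_self_of_disjoint hCd.symm]

end Cover

end TensorNetwork

/-! ### Messages on full configurations, and positivity of the constants. -/

namespace TensorNetwork

variable {V E X : Type*} [Fintype V] [Fintype E] [Fintype X] (N : TensorNetwork V E X) {ℓ : ℕ}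

section Update

/-- The product of tensors and messages, on a full configuration. -/
noncomputable def weightAt (m : N.Messages ℓ) (A : Finset V) (τ : V → V) (x : E → X) : ℝ :=
  ∏ k ∈ A, (N.tensorAt k x * m k (τ k) fun e => x e)

lemma weight_restrict (m : N.Messages ℓ) (A : Finset V) (τ : V → V) (x : E → X) :
    N.weight ℓ m A τ (fun e => x e) = N.weightAt m A τ x :=
  Finset.prod_coe_sort A fun k => N.tensorAt k x * m k (τ k) fun e => x e

lemma weight_congr {m m' : N.Messages ℓ} {A : Finset V} {τ : V → V}
    (h : ∀ k ∈ A, m k (τ k) = m' k (τ k)) (x : N.vars A → X) :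
    N.weight ℓ m A τ x = N.weight ℓ m' A τ x :=
  Finset.prod_congr rfl fun k _ => by rw [h k k.2]

lemma weight_mul (c : V → V → ℝ) (m : N.Messages ℓ) (A : Finset V) (τ : V → V)
    (x : N.vars A → X) :
    N.weight ℓ (fun k i y => c k i * m k i y) A τ x =
      (∏ k ∈ A, c k (τ k)) * N.weight ℓ m A τ x := by
  rw [← Finset.prod_coe_sort A fun k => c k (τ k), weight, weight, ← Finset.prod_mul_distrib]
  exact Finset.prod_congr rfl fun k _ => by ring

lemma weight_nonneg {m : N.Messages ℓ} (hm : ∀ i j y, 0 ≤ m i j y) (A : Finset V) (τ : V → V)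
    (x : N.vars A → X) : 0 ≤ N.weight ℓ m A τ x :=
  Finset.prod_nonneg fun _ _ => mul_nonneg (N.tensor_nonneg _ _) (hm _ _ _)

lemma contract_congr {m m' : N.Messages ℓ} {A : Finset V} {τ : V → V}
    (h : ∀ k ∈ A, m k (τ k) = m' k (τ k)) : N.contract ℓ m A τ = N.contract ℓ m' A τ :=
  Finset.sum_congr rfl fun x _ => N.weight_congr h x

lemma contract_mul (c : V → V → ℝ) (m : N.Messages ℓ) (A : Finset V) (τ : V → V) :
    N.contract ℓ (fun k i y => c k i * m k i y) A τ =
      (∏ k ∈ A, c k (τ k)) * N.contract ℓ m A τ := by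
  rw [contract, contract, Finset.mul_sum]
  exact Finset.sum_congr rfl fun x _ => N.weight_mul c m A τ x

lemma contract_eq_partialTrace (m : N.Messages ℓ) (A : Finset V) (τ : V → V) (x : E → X) :
    N.contract ℓ m A τ = partialTrace (N.vars A) (N.weightAt m A τ) x := by
  classical
  have h := sum_restrict_eq_partialTrace (C := ∅) (N.weight ℓ m A τ) x
  simp only [Finset.sdiff_empty, weight_restrict] at h
  rw [contract, ← partialTrace_congr _ (fun _ => rfl), ← h]
  exact Finset.sum_congr (by ext; simp) fun _ _ => rfl

lemma rawUpdate_congr {m m' : N.Messages ℓ} {i j : V}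
    (h : ∀ k ∈ N.nbhdDiff ℓ i j, m k i = m' k i) :
    N.rawUpdate ℓ m i j = N.rawUpdate ℓ m' i j :=
  funext fun _ => Finset.sum_congr rfl fun x _ => N.weight_congr h x

lemma update_congr {m m' : N.Messages ℓ} {i j : V}
    (h : ∀ k ∈ N.nbhdDiff ℓ i j, m k i = m' k i) :
    N.update ℓ m i j = N.update ℓ m' i j := by
  funext y
  rw [update, update, normConst, normConst, N.rawUpdate_congr h]

lemma rawUpdate_mul (c : V → V → ℝ) (m : N.Messages ℓ) (i j : V) (y : N.outVars ℓ i j → X) :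
    N.rawUpdate ℓ (fun k i y => c k i * m k i y) i j y =
      (∏ k ∈ N.nbhdDiff ℓ i j, c k i) * N.rawUpdate ℓ m i j y := by
  rw [rawUpdate, rawUpdate, Finset.mul_sum]
  exact Finset.sum_congr rfl fun x _ => N.weight_mul c m _ _ x

lemma rawUpdate_eq_partialTrace [DecidableEq E] (m : N.Messages ℓ) (i j : V) (x : E → X) :
    N.rawUpdate ℓ m i j (fun e => x e) =
      partialTrace (N.vars (N.nbhdDiff ℓ i j) \ N.outVars ℓ i j)
        (N.weightAt m (N.nbhdDiff ℓ i j) fun _ => i) x := by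
  classical
  have h := sum_restrict_eq_partialTrace (C := N.outVars ℓ i j)
    (N.weight ℓ m (N.nbhdDiff ℓ i j) fun _ => i) x
  simp only [weight_restrict] at h
  rw [rawUpdate]
  refine Eq.trans (Finset.sum_congr ?_ fun _ _ => rfl) (h.trans ?_)
  · ext y
    simp only [Finset.mem_filter, Finset.mem_univ, true_and, funext_iff, Subtype.forall]
    exact ⟨fun h' e _ he => h' e he,
      fun h' e he => h' e (N.outVars_subset_vars_nbhdDiff ℓ i j he) he⟩
  · congr!

lemma normConst_eq_contract (m : N.Messages ℓ) (i j : V) :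
    N.normConst ℓ m i j = N.contract ℓ m (N.nbhdDiff ℓ i j) fun _ => i := by
  classical
  rw [normConst, contract]
  simp only [rawUpdate]
  convert Finset.sum_fiberwise Finset.univ
    (fun (x : N.vars (N.nbhdDiff ℓ i j) → X) (e : N.outVars ℓ i j) =>
      x ⟨e, N.outVars_subset_vars_nbhdDiff ℓ i j e.2⟩)
    (N.weight ℓ m (N.nbhdDiff ℓ i j) fun _ => i)

lemma rawUpdate_nonneg {m : N.Messages ℓ} (hm : ∀ i j y, 0 ≤ m i j y) (i j : V)
    (y : N.outVars ℓ i j → X) : 0 ≤ N.rawUpdate ℓ m i j y :=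
  Finset.sum_nonneg fun _ _ => N.weight_nonneg hm _ _ _

lemma normConst_nonneg {m : N.Messages ℓ} (hm : ∀ i j y, 0 ≤ m i j y) (i j : V) :
    0 ≤ N.normConst ℓ m i j :=
  Finset.sum_nonneg fun _ _ => N.rawUpdate_nonneg hm _ _ _

end Update

lemma accumConst_succ (t : ℕ) (i j : V) : N.accumConst ℓ (t + 1) i j =
    N.normConst ℓ (N.messages ℓ t) i j * ∏ k ∈ N.nbhdDiff ℓ i j, N.accumConst ℓ t k i := rfl

lemma accumConst_self (x : E → X) (t : ℕ) (i : V) : N.accumConst ℓ t i i = 1 := by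
  cases t with
  | zero => rfl
  | succ t =>
    have h : N.nbhdDiff ℓ i i = ∅ := by
      classical
      exact Finset.sdiff_self _
    have hv : N.vars ∅ = ∅ := by
      ext e
      simp [mem_vars_iff]
    rw [accumConst_succ, normConst_eq_contract, h, N.contract_eq_partialTrace _ _ _ x, hv,
      partialTrace_empty, weightAt, Finset.prod_empty, Finset.prod_empty, mul_one]

section Positivity

variable {x : E → X} (hx : N.value x ≠ 0)

include hx

omit [Fintype E] [Fintype X] in
lemma tensorAt_pos (k : V) : 0 < N.tensorAt k x :=
  lt_of_le_of_ne (N.tensor_nonneg _ _) (Ne.symm (Finset.prod_ne_zero_iff.1 hx k (Finset.mem_univ k)))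

lemma rawUpdate_pos {m : N.Messages ℓ} (hm : ∀ i j y, 0 ≤ m i j y)
    (hmx : ∀ i j, 0 < m i j fun e => x e) (i j : V) :
    0 < N.rawUpdate ℓ m i j fun e => x e := by
  classical
  have h : 0 < N.weight ℓ m (N.nbhdDiff ℓ i j) (fun _ => i) (fun e => x e) := by
    rw [weight_restrict]
    exact Finset.prod_pos fun k _ => mul_pos (N.tensorAt_pos hx k) (hmx _ _)
  refine h.trans_le ?_
  exact Finset.single_le_sum (f := N.weight ℓ m (N.nbhdDiff ℓ i j) fun _ => i)
    (fun y _ => N.weight_nonneg hm _ _ y) (by simp)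

lemma normConst_pos {m : N.Messages ℓ} (hm : ∀ i j y, 0 ≤ m i j y)
    (hmx : ∀ i j, 0 < m i j fun e => x e) (i j : V) : 0 < N.normConst ℓ m i j := by
  classical
  refine (N.rawUpdate_pos hx hm hmx i j).trans_le ?_
  exact Finset.single_le_sum (f := N.rawUpdate ℓ m i j)
    (fun y _ => N.rawUpdate_nonneg hm _ _ y) (Finset.mem_univ _)

/-- At a configuration of nonzero value all tensors are positive, so every normalization constant
has a positive summand and no update divides by zero. -/
lemma messages_nonneg_and_pos (t : ℕ) : (∀ i j y, 0 ≤ N.messages ℓ t i j y) ∧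
    ∀ i j, 0 < N.messages ℓ t i j fun e => x e := by
  induction t with
  | zero =>
    refine ⟨fun i j y => ?_, fun i j => ?_⟩
    · simp only [messages]
      positivity
    · simp only [messages]
      refine one_div_pos.2 ?_
      -- `X` may be empty when there are no variables; the power is then `1`.
      rcases (N.outVars ℓ i j).eq_empty_or_nonempty with h | ⟨e, -⟩
      · simp [h]
      · have : Nonempty X := ⟨x e⟩
        exact pow_pos (by exact_mod_cast Fintype.card_pos) _
  | succ t ih =>
    exact ⟨fun i j y => div_nonneg (N.rawUpdate_nonneg ih.1 _ _ _) (N.normConst_nonneg ih.1 _ _),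
      fun i j => div_pos (N.rawUpdate_pos hx ih.1 ih.2 _ _) (N.normConst_pos hx ih.1 ih.2 _ _)⟩

lemma normConst_messages_pos (t : ℕ) (i j : V) : 0 < N.normConst ℓ (N.messages ℓ t) i j :=
  N.normConst_pos hx (N.messages_nonneg_and_pos hx t).1 (N.messages_nonneg_and_pos hx t).2 i j

lemma accumConst_pos (t : ℕ) (i j : V) : 0 < N.accumConst ℓ t i j := by
  induction t generalizing i j with
  | zero => simp [accumConst]
  | succ t ih =>
    exact mul_pos (N.normConst_messages_pos hx t i j) (Finset.prod_pos fun k _ => ih k i)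

/-- The update is multilinear, so the accumulated constants pull out and the newest one cancels the
normalization. -/
lemma rawMessages_succ (t : ℕ) (i j : V) :
    N.rawMessages ℓ (t + 1) i j = N.rawUpdate ℓ (N.rawMessages ℓ t) i j := by
  funext y
  have hc := (N.normConst_messages_pos hx (ℓ := ℓ) t i j).ne'
  change _ = N.rawUpdate ℓ (fun k i y => N.accumConst ℓ t k i * N.messages ℓ t k i y) i j y
  rw [rawUpdate_mul, rawMessages, accumConst_succ, messages, update]
  field_simp

end Positivity

lemma accumConst_congr {i j j' : V} (h : N.nbhdDiff ℓ i j = N.nbhdDiff ℓ i j') (t : ℕ) :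
    N.accumConst ℓ t i j = N.accumConst ℓ t i j' := by
  cases t with
  | zero => rfl
  | succ t => rw [accumConst_succ, accumConst_succ, normConst_eq_contract, normConst_eq_contract, h]

lemma nbhdTrace_rawMessages (t : ℕ) (i : V) : N.nbhdTrace ℓ (N.rawMessages ℓ t) i =
    (∏ k ∈ N.nbhd ℓ i, N.accumConst ℓ t k i) * N.nbhdTrace ℓ (N.messages ℓ t) i :=
  N.contract_mul _ _ _ _

lemma interTrace_rawMessages (t : ℕ) (i j : V) : N.interTrace ℓ (N.rawMessages ℓ t) i j =
    (∏ k ∈ N.nbhdInter ℓ i j, N.accumConst ℓ t k (pairTarget i j k)) *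
      N.interTrace ℓ (N.messages ℓ t) i j :=
  N.contract_mul _ _ _ _

lemma Z_eq_partialTrace (x : E → X) :
    N.Z = partialTrace Finset.univ (fun z => ∏ v, N.tensorAt v z) x :=
  Finset.sum_congr (by ext; simp) fun _ _ => rfl

lemma exists_value_ne_zero (hZ : N.Z ≠ 0) : ∃ x, N.value x ≠ 0 := by
  obtain ⟨x, -, hx⟩ := Finset.exists_ne_zero_of_sum_ne_zero hZ
  exact ⟨x, hx⟩

omit [Fintype E] [Fintype X] in
lemma value_nonneg (x : E → X) : 0 ≤ N.value x := Finset.prod_nonneg fun _ _ => N.tensor_nonneg _ _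

lemma Z_nonneg : 0 ≤ N.Z := Finset.sum_nonneg fun _ _ => N.value_nonneg _

lemma prob_nonneg (x : E → X) : 0 ≤ N.prob x := div_nonneg (N.value_nonneg x) N.Z_nonneg

lemma prob_le_marginal (A : Finset V) (x : E → X) :
    N.prob x ≤ N.marginal A ((N.vars A).restrict x) := by
  classical
  exact Finset.single_le_sum (f := N.prob) (fun z _ => N.prob_nonneg z) (by simp)

/-- The variables summed out are exactly the inner variables of the branches. -/
lemma marginal_eq {K : Finset V} {τ : V → V} (h : N.graph.IsBranchCover K τ Finset.univ)
    (x : E → X) : N.marginal K ((N.vars K).restrict x) =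
      (∏ k ∈ K, (N.tensorAt k x * N.branchSum k (τ k) x)) / N.Z := by
  classical
  have hd := N.disjoint_vars_biUnion h
  have hu := N.vars_union_biUnion h
  rw [vars_univ] at hu
  rw [N.prod_branchSum h, marginal, partialTrace, Finset.sum_div]
  refine Finset.sum_congr ?_ fun _ _ => rfl
  ext z
  simp only [Finset.mem_filter, Finset.mem_univ, true_and, funext_iff, Finset.restrict,
    Subtype.forall]
  refine forall_congr' fun e => ⟨fun h1 h2 => h1 ?_, fun h1 h2 => h1 (Finset.disjoint_left.1 hd h2)⟩
  have : e ∈ N.vars K ∪ _ := hu ▸ Finset.mem_univ e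
  exact (Finset.mem_union.1 this).resolve_right h2

lemma prod_rpow_accumConst_pos (hZ : N.Z ≠ 0) (P : Finset (V × V)) (t : ℕ) :
    0 < ∏ q ∈ P, (∏ k ∈ N.nbhdInter ℓ q.1 q.2, N.accumConst ℓ t k (pairTarget q.1 q.2 k)) ^
        (2 / ((N.nbhdInter ℓ q.1 q.2).card : ℝ)) := by
  obtain ⟨x, hx⟩ := N.exists_value_ne_zero hZ
  exact Finset.prod_pos fun q _ => Real.rpow_pos_of_pos
    (Finset.prod_pos fun k _ => N.accumConst_pos hx t _ _) _

/-! ### Exactness of the messages, and the product formulas. -/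

section Tree

variable (hconn : N.graph.Connected) (hloops : N.LoopsBounded ℓ)

include hconn hloops

omit [Fintype E] [Fintype X] in
lemma mem_nbhd_symm {i j : V} (h : j ∈ N.nbhd ℓ i) : i ∈ N.nbhd ℓ j :=
  (N.mem_nbhd hconn hloops).2 ((N.mem_nbhd hconn hloops).1 h).symm

omit [Fintype E] [Fintype X] in
lemma cover_nbhd (i : V) : N.graph.IsBranchCover (N.nbhd ℓ i) (fun _ => i) Finset.univ :=
  SimpleGraph.isBranchCover_nbhd hconn (fun _ _ => N.mem_nbhd hconn hloops) i

omit [Fintype E] [Fintype X] in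
lemma cover_nbhdDiff {i j : V} (h : j ∈ N.nbhd ℓ i) :
    N.graph.IsBranchCover (N.nbhdDiff ℓ i j) (fun _ => i) (N.graph.branch i j) := by
  classical
  exact SimpleGraph.isBranchCover_nbhdDiff hconn (fun _ _ => N.mem_nbhd hconn hloops) h

omit [Fintype E] [Fintype X] in
lemma cover_nbhdInter {i j : V} (hij : i ≠ j) (h : j ∈ N.nbhd ℓ i) :
    N.graph.IsBranchCover (N.nbhdInter ℓ i j) (pairTarget i j) Finset.univ := by
  classical
  exact SimpleGraph.isBranchCover_nbhdInter hconn (fun _ _ => N.mem_nbhd hconn hloops) hij h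

omit [Fintype E] [Fintype X] in
lemma card_branch_lt_of_mem_nbhdDiff {i j k : V} (h : j ∈ N.nbhd ℓ i)
    (hk : k ∈ N.nbhdDiff ℓ i j) :
    i ∈ N.nbhd ℓ k ∧ (N.graph.branch k i).card < (N.graph.branch i j).card := by
  classical
  exact ⟨N.mem_nbhd_symm hconn hloops (Finset.mem_sdiff.1 hk).1,
    SimpleGraph.card_branch_lt hconn (fun _ _ => N.mem_nbhd hconn hloops) h hk⟩

omit [Fintype X] in
-- A variable leaves the branch only through `i`, and a branch vertex at its other end is outside
-- `S_j`. So the variables kept by the update are the boundary of the branch.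
lemma innerVars_branch [DecidableEq E] (i j : V) :
    N.innerVars (N.graph.branch i j) = N.vars (N.graph.branch i j) \ N.outVars ℓ i j := by
  classical
  ext e
  simp only [mem_innerVars, Finset.mem_sdiff, mem_vars_iff, outVars, Finset.mem_filter,
    Finset.mem_univ, true_and, not_and, not_exists, not_not]
  constructor
  · intro he
    obtain ⟨k, hk⟩ := N.exists_mem_ends e
    exact ⟨⟨k, he k hk, hk⟩, fun hi => absurd (he i hi) (SimpleGraph.notMem_branch_self _ _)⟩
  · rintro ⟨⟨u, hu, hue⟩, hout⟩ w hw
    have hi : i ∉ N.ends e := by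
      intro hi
      have huj := hout hi u hue
      rw [N.mem_nbhd hconn hloops] at huj
      obtain ⟨hui, hji, hA⟩ := SimpleGraph.mem_branch.1 hu
      exact hA (huj i hji.symm hui.symm)
    by_cases huw : u = w
    · exact huw ▸ hu
    · exact mem_branch_of_adj hu (N.adj_of_mem_ends hue hw huw) fun h' => hi (h' ▸ hw)

/-- Each update glues the smaller branches at `S_i \ S_j` into the branch of `i` away from `j`. The
strict bound makes `t = 0` vacuous, so the initial messages never enter. -/
lemma rawMessages_eq_branchSum (hZ : N.Z ≠ 0) (t : ℕ) {i j : V} (h : j ∈ N.nbhd ℓ i)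
    (ht : (N.graph.branch i j).card < t) (x : E → X) :
    N.rawMessages ℓ t i j (fun e => x e) = N.branchSum i j x := by
  classical
  obtain ⟨x₀, hx₀⟩ := N.exists_value_ne_zero hZ
  induction t generalizing i j x with
  | zero => exact absurd ht (Nat.not_lt_zero _)
  | succ t ih =>
    rw [N.rawMessages_succ hx₀, rawUpdate_eq_partialTrace, branchSum,
      N.innerVars_branch hconn hloops,
      ← N.partialTrace_prod_branchSum (N.cover_nbhdDiff hconn hloops h)
        (N.outVars_subset_vars_nbhdDiff ℓ i j)]
    refine partialTrace_congr _ (fun z => Finset.prod_congr rfl fun k hk => ?_) x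
    obtain ⟨h1, h2⟩ := N.card_branch_lt_of_mem_nbhdDiff hconn hloops h hk
    rw [ih h1 (by omega)]

lemma contract_rawMessages_eq_Z (hZ : N.Z ≠ 0) {K : Finset V} {τ : V → V}
    (h : N.graph.IsBranchCover K τ Finset.univ) (hτ : ∀ k ∈ K, τ k ∈ N.nbhd ℓ k) {t : ℕ}
    (ht : Fintype.card V ≤ t) : N.contract ℓ (N.rawMessages ℓ t) K τ = N.Z := by
  classical
  obtain ⟨x, -⟩ := N.exists_value_ne_zero hZ
  have key := N.partialTrace_prod_branchSum h (Finset.empty_subset _) x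
  rw [Finset.sdiff_empty, Finset.sdiff_empty, vars_univ] at key
  rw [N.contract_eq_partialTrace _ _ _ x, N.Z_eq_partialTrace x, ← key]
  refine partialTrace_congr _ (fun z => Finset.prod_congr rfl fun k hk => ?_) x
  rw [N.rawMessages_eq_branchSum hconn hloops hZ t (hτ k hk) (lt_of_lt_of_le ?_ ht)]
  exact Finset.card_lt_univ_of_notMem (SimpleGraph.notMem_branch_self _ _)

lemma nbhdTrace_rawMessages_eq_Z (hZ : N.Z ≠ 0) {t : ℕ} (ht : Fintype.card V ≤ t) (i : V) :
    N.nbhdTrace ℓ (N.rawMessages ℓ t) i = N.Z :=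
  N.contract_rawMessages_eq_Z hconn hloops hZ (N.cover_nbhd hconn hloops i)
    (fun _ hk => N.mem_nbhd_symm hconn hloops hk) ht

lemma interTrace_rawMessages_eq_Z (hZ : N.Z ≠ 0) {t : ℕ} (ht : Fintype.card V ≤ t) {i j : V}
    (h : N.IsNbhdPair ℓ i j) : N.interTrace ℓ (N.rawMessages ℓ t) i j = N.Z := by
  classical
  refine N.contract_rawMessages_eq_Z hconn hloops hZ (N.cover_nbhdInter hconn hloops h.1 h.2.2)
    (fun k hk => ?_) ht
  have hk' := Finset.mem_inter.1 hk
  unfold pairTarget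
  split_ifs with hkj
  · exact hkj ▸ h.2.1
  · exact N.mem_nbhd_symm hconn hloops hk'.2

lemma messages_succ_eq (t : ℕ) {i j : V} (h : j ∈ N.nbhd ℓ i)
    (ht : (N.graph.branch i j).card < t) : N.messages ℓ (t + 1) i j = N.messages ℓ t i j := by
  induction t generalizing i j with
  | zero => exact absurd ht (Nat.not_lt_zero _)
  | succ t ih =>
    refine N.update_congr fun k hk => ?_
    obtain ⟨h1, h2⟩ := N.card_branch_lt_of_mem_nbhdDiff hconn hloops h hk
    exact ih h1 (by omega)

lemma messages_succ_eq_of_card_le {t : ℕ} (ht : Fintype.card V ≤ t) {i j : V}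
    (h : j ∈ N.nbhd ℓ i) : N.messages ℓ (t + 1) i j = N.messages ℓ t i j :=
  N.messages_succ_eq hconn hloops t h (lt_of_lt_of_le
    (Finset.card_lt_univ_of_notMem (SimpleGraph.notMem_branch_self _ _)) ht)

lemma isConverged_messages {t : ℕ} (ht : Fintype.card V ≤ t) :
    N.IsConverged ℓ (N.messages ℓ t) := fun _ _ h =>
  (N.messages_succ_eq_of_card_le hconn hloops ht h).symm

/-- Along strictly nested branches the fixed-point equation is an explicit recursion, which ends
where `S_i \ S_j` is empty. -/
lemma IsConverged.unique {m m' : N.Messages ℓ} (hm : N.IsConverged ℓ m)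
    (hm' : N.IsConverged ℓ m') {i j : V} (h : j ∈ N.nbhd ℓ i) : m i j = m' i j := by
  induction hn : (N.graph.branch i j).card using Nat.strong_induction_on generalizing i j with
  | _ n ih =>
    rw [hm i j h, hm' i j h]
    refine N.update_congr fun k hk => ?_
    obtain ⟨h1, h2⟩ := N.card_branch_lt_of_mem_nbhdDiff hconn hloops h hk
    exact ih _ (hn ▸ h2) h1 rfl

lemma accumConst_congr_of_mem {k i i' : V} (hi : i ≠ k) (hi' : i' ≠ k) (h : i ∈ N.nbhd ℓ k)
    (h' : i' ∈ N.nbhd ℓ k) (h'' : i' ∈ N.nbhd ℓ i) (t : ℕ) :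
    N.accumConst ℓ t k i = N.accumConst ℓ t k i' := by
  classical
  exact N.accumConst_congr
    (SimpleGraph.sdiff_congr (fun _ _ => N.mem_nbhd hconn hloops) hi hi' h h' h'') t

/-- At `i` and `j` both orders choose the same target. At any other `k` the targets `i` and `j` lie
in one block with `k`, so the constants agree. -/
lemma prod_accumConst_comm {i j : V} (h : N.IsNbhdPair ℓ i j) (t : ℕ) :
    ∏ k ∈ N.nbhdInter ℓ i j, N.accumConst ℓ t k (pairTarget i j k) =
      ∏ k ∈ N.nbhdInter ℓ j i, N.accumConst ℓ t k (pairTarget j i k) := by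
  classical
  have hc : N.nbhdInter ℓ i j = N.nbhdInter ℓ j i := Finset.inter_comm _ _
  rw [hc]
  refine Finset.prod_congr rfl fun k hk => ?_
  have hk' := Finset.mem_inter.1 hk
  unfold pairTarget
  split_ifs with h1 h2 h2
  · exact absurd (h2.symm.trans h1) h.1
  · rfl
  · rfl
  · exact N.accumConst_congr_of_mem hconn hloops (Ne.symm h1) (Ne.symm h2)
      (N.mem_nbhd_symm hconn hloops hk'.1) (N.mem_nbhd_symm hconn hloops hk'.2) h.2.1 t

omit [Fintype E] [Fintype X] in
lemma IsPairList.isPairSelection {P : Finset (V × V)} (hP : N.IsPairList ℓ P) :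
    SimpleGraph.IsPairSelection (N.nbhd ℓ) P :=
  ⟨fun q hq => (hP.1 q hq).1, fun q hq => (hP.1 q hq).2.2,
    fun i j hij h => hP.2 i j ⟨hij, N.mem_nbhd_symm hconn hloops h, h⟩⟩

omit [Fintype E] [Fintype X] in
lemma prod_prod_nbhd_eq {P : Finset (V × V)} (hP : N.IsPairList ℓ P)
    (f : V → V → ℝ) (hf0 : ∀ k i, 0 ≤ f k i)
    (hf : ∀ k i i', i ≠ k → i' ≠ k → i ∈ N.nbhd ℓ k → i' ∈ N.nbhd ℓ k → i' ∈ N.nbhd ℓ i →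
      f k i = f k i') :
    ∏ i, ∏ k ∈ N.nbhd ℓ i, f k i = (∏ i, f i i) *
      ∏ q ∈ P, (∏ k ∈ N.nbhdInter ℓ q.1 q.2, f k (pairTarget q.1 q.2 k)) ^
        (2 / ((N.nbhdInter ℓ q.1 q.2).card : ℝ)) := by
  classical
  have := SimpleGraph.prod_prod_eq_mul_prod_rpow (G := N.graph)
    (fun _ _ => N.mem_nbhd hconn hloops) (hP.isPairSelection N hconn hloops) f hf0 hf
  exact this

lemma Z_mul_prod_rpow {P : Finset (V × V)} (hP : N.IsPairList ℓ P) :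
    N.Z * ∏ q ∈ P, N.Z ^ (2 / ((N.nbhdInter ℓ q.1 q.2).card : ℝ)) = N.Z ^ Fintype.card V := by
  classical
  have := SimpleGraph.mul_prod_rpow_eq_pow_card (G := N.graph)
    (fun _ _ => N.mem_nbhd hconn hloops) hconn (hP.isPairSelection N hconn hloops) N.Z_nonneg
  exact this

lemma prod_accumConst (hZ : N.Z ≠ 0) {P : Finset (V × V)} (hP : N.IsPairList ℓ P) (t : ℕ) :
    ∏ i, ∏ k ∈ N.nbhd ℓ i, N.accumConst ℓ t k i =
      ∏ q ∈ P, (∏ k ∈ N.nbhdInter ℓ q.1 q.2, N.accumConst ℓ t k (pairTarget q.1 q.2 k)) ^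
        (2 / ((N.nbhdInter ℓ q.1 q.2).card : ℝ)) := by
  obtain ⟨x, hx⟩ := N.exists_value_ne_zero hZ
  rw [N.prod_prod_nbhd_eq hconn hloops hP (N.accumConst ℓ t)
    (fun _ _ => (N.accumConst_pos hx t _ _).le) fun k i i' h1 h2 h3 h4 h5 =>
      N.accumConst_congr_of_mem hconn hloops h1 h2 h3 h4 h5 t]
  simp only [N.accumConst_self x, Finset.prod_const_one, one_mul]

/-- By uniqueness the messages are those of step `|V|`, whose unnormalized contraction is `Z`. -/
lemma interTrace_of_isConverged (hZ : N.Z ≠ 0) {m : N.Messages ℓ} (hm : N.IsConverged ℓ m)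
    {i j : V} (h : N.IsNbhdPair ℓ i j) : N.interTrace ℓ m i j = N.Z /
      ∏ k ∈ N.nbhdInter ℓ i j, N.accumConst ℓ (Fintype.card V) k (pairTarget i j k) := by
  classical
  obtain ⟨x, hx⟩ := N.exists_value_ne_zero hZ
  rw [eq_div_iff (Finset.prod_pos fun k _ => N.accumConst_pos hx _ _ _).ne', mul_comm,
    ← N.interTrace_rawMessages_eq_Z hconn hloops hZ le_rfl h, interTrace_rawMessages]
  congr 1
  refine N.contract_congr fun k hk => hm.unique N hconn hloops
    (N.isConverged_messages hconn hloops le_rfl) ?_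
  have hk' := Finset.mem_inter.1 hk
  unfold pairTarget
  split_ifs with hkj
  · exact hkj ▸ h.2.1
  · exact N.mem_nbhd_symm hconn hloops hk'.2

lemma nbhdTrace_of_isConverged (hZ : N.Z ≠ 0) {m : N.Messages ℓ} (hm : N.IsConverged ℓ m)
    (i : V) : N.nbhdTrace ℓ m i = N.Z /
      ∏ k ∈ N.nbhd ℓ i, N.accumConst ℓ (Fintype.card V) k i := by
  obtain ⟨x, hx⟩ := N.exists_value_ne_zero hZ
  rw [eq_div_iff (Finset.prod_pos fun k _ => N.accumConst_pos hx _ _ _).ne', mul_comm,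
    ← N.nbhdTrace_rawMessages_eq_Z hconn hloops hZ le_rfl i, nbhdTrace_rawMessages]
  congr 1
  exact N.contract_congr fun k hk => hm.unique N hconn hloops
    (N.isConverged_messages hconn hloops le_rfl) (N.mem_nbhd_symm hconn hloops hk)

lemma Z_eq_of_isConverged (hZ : N.Z ≠ 0) {m : N.Messages ℓ} (hm : N.IsConverged ℓ m)
    {P : Finset (V × V)} (hP : N.IsPairList ℓ P) :
    N.Z = (∏ i, N.nbhdTrace ℓ m i) /
      ∏ q ∈ P, N.interTrace ℓ m q.1 q.2 ^ (2 / ((N.nbhdInter ℓ q.1 q.2).card : ℝ)) := by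
  obtain ⟨x, hx⟩ := N.exists_value_ne_zero hZ
  have hZpos : 0 < N.Z := lt_of_le_of_ne N.Z_nonneg hZ.symm
  have h1 : ∏ q ∈ P, N.interTrace ℓ m q.1 q.2 ^ (2 / ((N.nbhdInter ℓ q.1 q.2).card : ℝ)) =
      (∏ q ∈ P, N.Z ^ (2 / ((N.nbhdInter ℓ q.1 q.2).card : ℝ))) /
        ∏ q ∈ P, (∏ k ∈ N.nbhdInter ℓ q.1 q.2,
          N.accumConst ℓ (Fintype.card V) k (pairTarget q.1 q.2 k)) ^
            (2 / ((N.nbhdInter ℓ q.1 q.2).card : ℝ)) := by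
    rw [← Finset.prod_div_distrib]
    refine Finset.prod_congr rfl fun q hq => ?_
    rw [N.interTrace_of_isConverged hconn hloops hZ hm (hP.1 q hq), Real.div_rpow hZpos.le
      (Finset.prod_nonneg fun k _ => (N.accumConst_pos hx _ _ _).le)]
  have h2 := N.prod_rpow_accumConst_pos hZ P (ℓ := ℓ) (Fintype.card V)
  have h3 : 0 < ∏ q ∈ P, N.Z ^ (2 / ((N.nbhdInter ℓ q.1 q.2).card : ℝ)) :=
    Finset.prod_pos fun q _ => Real.rpow_pos_of_pos hZpos _
  -- The accumulated constants cancel between numerator and denominator, and the leftover powers of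
  -- `Z` reduce to `Z`.
  rw [h1, Finset.prod_congr rfl fun i _ => N.nbhdTrace_of_isConverged hconn hloops hZ hm i,
    Finset.prod_div_distrib, N.prod_accumConst hconn hloops hZ hP, Finset.prod_const,
    Finset.card_univ, ← N.Z_mul_prod_rpow hconn hloops hP, div_div_div_cancel_right₀ h2.ne',
    mul_div_cancel_right₀ _ h3.ne']

lemma prob_eq_prod_marginal (hZ : N.Z ≠ 0) {P : Finset (V × V)} (hP : N.IsPairList ℓ P)
    (x : E → X) :
    N.prob x = (∏ i, N.marginal (N.nbhd ℓ i) ((N.vars (N.nbhd ℓ i)).restrict x)) /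
      ∏ q ∈ P, N.marginal (N.nbhdInter ℓ q.1 q.2)
        ((N.vars (N.nbhdInter ℓ q.1 q.2)).restrict x) ^
          (2 / ((N.nbhdInter ℓ q.1 q.2).card : ℝ)) := by
  have hZpos : 0 < N.Z := lt_of_le_of_ne N.Z_nonneg hZ.symm
  by_cases h0 : ∏ q ∈ P, N.marginal (N.nbhdInter ℓ q.1 q.2)
        ((N.vars (N.nbhdInter ℓ q.1 q.2)).restrict x) ^
          (2 / ((N.nbhdInter ℓ q.1 q.2).card : ℝ)) = 0
  -- A vanishing denominator contains a vanishing marginal, and `p(x)` is at most that marginal;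
  -- this matches division by zero.
  · rw [h0, div_zero]
    obtain ⟨q, -, hq⟩ := Finset.prod_eq_zero_iff.1 h0
    have hle := N.prob_le_marginal (N.nbhdInter ℓ q.1 q.2) x
    have hq0 := ((Real.rpow_eq_zero_iff_of_nonneg ((N.prob_nonneg x).trans hle)).1 hq).1
    exact le_antisymm (hle.trans hq0.le) (N.prob_nonneg x)
  · set f : V → V → ℝ := fun k i => N.tensorAt k x * N.branchSum k i x with hf
    have hf0 : ∀ k i, 0 ≤ f k i := fun k i =>
      mul_nonneg (N.tensor_nonneg _ _) (N.branchSum_nonneg _ _ _)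
    have key := N.prod_prod_nbhd_eq hconn hloops hP f hf0 fun k i i' h1 h2 _ _ h5 => by
      simp only [hf, branchSum, SimpleGraph.branch_congr h1 h2 ((N.mem_nbhd hconn hloops).1 h5)]
    have hself : ∏ i, f i i = N.value x := by
      simp only [hf, branchSum_self, mul_one]
      rfl
    have h1 : ∏ q ∈ P, N.marginal (N.nbhdInter ℓ q.1 q.2)
        ((N.vars (N.nbhdInter ℓ q.1 q.2)).restrict x) ^
          (2 / ((N.nbhdInter ℓ q.1 q.2).card : ℝ)) =
        (∏ q ∈ P, (∏ k ∈ N.nbhdInter ℓ q.1 q.2, f k (pairTarget q.1 q.2 k)) ^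
          (2 / ((N.nbhdInter ℓ q.1 q.2).card : ℝ))) /
          ∏ q ∈ P, N.Z ^ (2 / ((N.nbhdInter ℓ q.1 q.2).card : ℝ)) := by
      rw [← Finset.prod_div_distrib]
      refine Finset.prod_congr rfl fun q hq => ?_
      rw [N.marginal_eq (N.cover_nbhdInter hconn hloops (hP.1 q hq).1 (hP.1 q hq).2.2),
        Real.div_rpow (Finset.prod_nonneg fun k _ => hf0 _ _) hZpos.le]
    have h3 : 0 < ∏ q ∈ P, N.Z ^ (2 / ((N.nbhdInter ℓ q.1 q.2).card : ℝ)) :=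
      Finset.prod_pos fun q _ => Real.rpow_pos_of_pos hZpos _
    rw [h1] at h0 ⊢
    have h4 := (div_ne_zero_iff.1 h0).1
    rw [Finset.prod_congr rfl fun i _ => N.marginal_eq (N.cover_nbhd hconn hloops i) x,
      Finset.prod_div_distrib, key, hself, Finset.prod_const, Finset.card_univ,
      ← N.Z_mul_prod_rpow hconn hloops hP, prob]
    field_simp

end Tree

end TensorNetwork

theorem mainTheorem4 {V E X : Type*} [Fintype V] [Fintype E] [Fintype X]
    (N : TensorNetwork V E X) (ℓ : ℕ)
    (hconn : N.graph.Connected) (hZ : N.Z ≠ 0) (hloops : N.LoopsBounded ℓ) :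
    -- the iteration becomes stationary, and its unnormalized messages contract to `Z`
    (∃ T, ∀ t ≥ T,
      (∀ i, ∀ j ∈ N.nbhd ℓ i, N.messages ℓ t i j = N.messages ℓ T i j) ∧
      N.IsConverged ℓ (N.messages ℓ t) ∧
      (∀ i, N.Z = N.nbhdTrace ℓ (N.rawMessages ℓ t) i) ∧
      (∀ i j, N.IsNbhdPair ℓ i j → N.Z = N.interTrace ℓ (N.rawMessages ℓ t) i j)) ∧
    -- for converged messages, the intersection contractions are symmetric and the formula is exact
    (∀ m : N.Messages ℓ, N.IsConverged ℓ m →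
      (∀ i j, N.IsNbhdPair ℓ i j → N.interTrace ℓ m i j = N.interTrace ℓ m j i) ∧
      ∀ P, N.IsPairList ℓ P →
        N.Z = (∏ i, N.nbhdTrace ℓ m i) /
          ∏ q ∈ P, N.interTrace ℓ m q.1 q.2 ^ (2 / ((N.nbhdInter ℓ q.1 q.2).card : ℝ))) ∧
    -- the normalization constants of the messages cancel
    (∀ t P, N.IsPairList ℓ P →
      (∏ i, ∏ j ∈ N.nbhd ℓ i, N.accumConst ℓ t j i) /
        ∏ q ∈ P, (∏ k ∈ N.nbhdInter ℓ q.1 q.2,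
            N.accumConst ℓ t k (TensorNetwork.pairTarget q.1 q.2 k))
          ^ (2 / ((N.nbhdInter ℓ q.1 q.2).card : ℝ)) = 1) ∧
    -- the factorization of the distribution into neighborhood and intersection marginals
    (∀ P, N.IsPairList ℓ P → ∀ x : E → X,
      N.prob x = (∏ i, N.marginal (N.nbhd ℓ i) ((N.vars (N.nbhd ℓ i)).restrict x)) /
        ∏ q ∈ P, N.marginal (N.nbhdInter ℓ q.1 q.2)
            ((N.vars (N.nbhdInter ℓ q.1 q.2)).restrict x)
          ^ (2 / ((N.nbhdInter ℓ q.1 q.2).card : ℝ))) := by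
  -- `|V|` steps suffice because every branch misses its own root.
  refine ⟨⟨Fintype.card V, fun t ht => ⟨fun i j hj => ?_, N.isConverged_messages hconn hloops ht,
    fun i => (N.nbhdTrace_rawMessages_eq_Z hconn hloops hZ ht i).symm,
    fun i j h => (N.interTrace_rawMessages_eq_Z hconn hloops hZ ht h).symm⟩⟩,
    fun m hm => ⟨fun i j h => ?_, fun P hP => N.Z_eq_of_isConverged hconn hloops hZ hm hP⟩,
    fun t P hP => ?_, fun P hP x => N.prob_eq_prod_marginal hconn hloops hZ hP x⟩
  · induction t, ht using Nat.le_induction with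
    | base => rfl
    | succ t ht ih => rw [N.messages_succ_eq_of_card_le hconn hloops ht hj, ih]
  · rw [N.interTrace_of_isConverged hconn hloops hZ hm h,
      N.interTrace_of_isConverged hconn hloops hZ hm ⟨h.1.symm, h.2.2, h.2.1⟩,
      N.prod_accumConst_comm hconn hloops h]
  · rw [N.prod_accumConst hconn hloops hZ hP]
    exact div_self (N.prod_rpow_accumConst_pos hZ P t).ne'
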